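/- For a set $F\subset\mathbb{R}^n$ and $r>0$ let $N_r(F)$ be the minimal number of closed axis-parallel cubes of side length $r$ needed to cover $F$. The lower box dimension of a bounded set $F$ is $$\underline{\dim}_B F=\liminf_{r\to 0^+}\frac{\log N_r(F)}{-\log r},$$ and the Assouad dimension of $F$ is $$\dim_A F=\inf\Big\{s\ge 0:\ \exists\,C>0\ \ \forall R>0\ \ \forall r\in(0,R)\ \ \forall x\in F:\ N_r(B(x,R)\cap F)\le C\Big(\frac Rr\Big)^s\Big\},$$ where $B(x,R)$ is the closed ball of centre $x$ and radius $R$. A dipole Kakeya set in $\mathbb{R}^n$ is a bounded set $A\subset\mathbb{R}^n$ such that $A-A\supset S^{n-1}$, where $A-A=\{y-x:x,y\in A\}$ and $S^{n-1}$ is the Euclidean unit sphere. Theorem. Every dipole Kakeya set $A\subset\mathbb{R}^2$ satisfies $$\underline{\dim}_B A\ge\frac47\qquad\text{and}\qquad \dim_A A\ge\frac23 .$$ Conversely, for each $n\ge 2$ there exists a compact dipole Kakeya set $A\subset\mathbb{R}^n$ with $$\underline{\dim}_B A\le\frac{n(n-1)}{2n-1}.$$ -/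

import Mathlib

open Filter Topology
open scoped ENNReal Pointwise

/-- The closed axis-parallel cube of side length `r` in `ℝⁿ` with lowest corner `a`. -/
def cube {n : ℕ} (a : EuclideanSpace ℝ (Fin n)) (r : ℝ) : Set (EuclideanSpace ℝ (Fin n)) :=
  {x | ∀ i, a i ≤ x i ∧ x i ≤ a i + r}

/-- `N_r(F)`: the minimal number of cubes of side length `r` needed to cover `F`
(equal to `⊤` if no finite family of such cubes covers `F`). -/
noncomputable def coverNum {n : ℕ} (r : ℝ) (F : Set (EuclideanSpace ℝ (Fin n))) : ℕ∞ :=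
  ⨅ (T : Set (EuclideanSpace ℝ (Fin n))) (_ : F ⊆ ⋃ a ∈ T, cube a r), T.encard

/-- The lower box dimension of `F`: the lower limit of `log N_r(F) / (-log r)` as `r → 0⁺`. -/
noncomputable def lowerBoxDim {n : ℕ} (F : Set (EuclideanSpace ℝ (Fin n))) : EReal :=
  liminf (fun r : ℝ => ENNReal.log (coverNum r F : ℝ≥0∞) / ((-Real.log r : ℝ) : EReal)) (𝓝[>] 0)

/-- The Assouad dimension of `F`: the infimum of the exponents `s ≥ 0` for which there is a
constant `C` with `N_r(B(x,R) ∩ F) ≤ C (R/r)^s` for all `0 < r < R` and `x ∈ F`. -/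
noncomputable def assouadDim {n : ℕ} (F : Set (EuclideanSpace ℝ (Fin n))) : EReal :=
  ⨅ (s : ℝ) (_ : 0 ≤ s ∧ ∃ C : ℝ, 0 < C ∧ ∀ R : ℝ, 0 < R → ∀ r : ℝ, 0 < r → r < R → ∀ x ∈ F,
    (coverNum r (Metric.closedBall x R ∩ F) : ℝ≥0∞) ≤ ENNReal.ofReal (C * (R / r) ^ s)), (s : EReal)

/-- A dipole Kakeya set in `ℝⁿ`: a bounded set whose difference set contains the unit sphere. -/
def IsDipoleKakeya {n : ℕ} (A : Set (EuclideanSpace ℝ (Fin n))) : Prop :=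
  Bornology.IsBounded A ∧ Metric.sphere (0 : EuclideanSpace ℝ (Fin n)) 1 ⊆ A - A

/-!
# Box and Assouad dimension of dipole Kakeya sets

**Lower bounds.** Cover a planar dipole Kakeya set by `N` cubes of side `δ`. About `1 / δ`
directions `e_j` in an arc of the circle, `3δ`-separated, are each realised by a pair of cubes with
corners `a j`, `b j`, so that `b j - a j = e_j + O(δ)` (`IsDiscreteArc`). The proof counts the
pairs of indices with `b j = b k`, the *paths* `a j - b j - a k`. By Cauchy–Schwarz there are at
least `M ^ 2 / N` of them, where `M` is the number of directions. Upper bounds come from two facts: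
* the directions are separated, so few paths have `a j` and `a k` close together
  (`IsDiscreteArc.card_paths_near_le`);
* the circle is curved: if `a j` and `a k` are at distance `D`, then all their common
  neighbours `b` lie within `O(δ / D)` of each other (`IsDiscreteArc.curvature`).

For the box dimension, let `τ = N ^ (-1/2)`. Paths with `D ≥ τ` number at most `O(N ^ 2 / τ)`.
As two balls of radius `O(τ)` realise at most `O(τ / δ)` directions, half of the indices have the
property that the balls of radius `5τ` around `a j` and `b j` contain `n` and `n'` corners with
`n * n' = O(τ N ^ 2)` (`IsDiscreteArc.exists_sparse_indices`); for such indices the paths with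
`δ / τ ≲ D < τ` number at most `O(τ N ^ 3)` (`IsDiscreteArc.card_paths_scale_le`). Altogether
`M ^ 2 = O(N ^ (7/2))`, so `N` is at least of order `δ ^ (-4/7)`.

For the Assouad dimension, let `s` be an admissible exponent. For each dyadic `D` there are
`O((D / δ) ^ s)` choices of `a k` given `a j`, and `O((1 / D) ^ s)` choices of `b`, so there are
`O(N δ ^ (-s) log (1 / δ))` paths, while `N = O(δ ^ (-s))`; this forces `3 * s ≥ 2`.

**Upper bound.** A `β`-net of the sphere together with a `δ`-net of a ball of radius `β` has
differences that are `δ`-dense in the sphere, and `β = δ ^ (n / (2n - 1))` makes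
both nets of size about `δ ^ (-n(n-1) / (2n-1))`. Given a finite set `P` whose differences are
`δ`-dense in the sphere, the same construction can be carried out inside the
`δ`-neighbourhood of `P` at a much smaller scale `δ'`, at the cost of a factor depending only on `P`
(`DifferencesCover.exists_refinement`). The intersection of the resulting nested neighbourhoods is
a compact dipole Kakeya set that is small along a sequence of scales.
-/

/-! ### Curvature of the upper unit semicircle -/

/-- The upper unit semicircle, as the graph of a function of the first coordinate. -/
noncomputable def semicircle (u : ℝ) : ℝ := √(1 - u ^ 2)

lemma abs_semicircle_sub_le {u v : ℝ} (hu : |u| ≤ 3 / 5) (hv : |v| ≤ 3 / 5) :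
    |semicircle u - semicircle v| ≤ |u - v| := by
  have key : ∀ w : ℝ, |w| ≤ 3 / 5 →
      4 / 5 ≤ semicircle w ∧ semicircle w ^ 2 = 1 - w ^ 2 := by
    intro w hw
    have h1 : w ^ 2 ≤ (3 / 5) ^ 2 := by
      rw [← sq_abs]; gcongr
    refine ⟨Real.le_sqrt_of_sq_le (by nlinarith), Real.sq_sqrt (by nlinarith)⟩
  obtain ⟨hU, hU2⟩ := key u hu
  obtain ⟨hV, hV2⟩ := key v hv
  have hprod : |semicircle u - semicircle v| * (semicircle u + semicircle v)
      = |u - v| * |u + v| := by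
    have hneg : (semicircle u - semicircle v) * (semicircle u + semicircle v)
        = -((u - v) * (u + v)) := by linear_combination hU2 - hV2
    rw [← abs_mul, ← abs_neg ((u - v) * (u + v)), ← hneg, abs_mul,
      abs_of_nonneg (show 0 ≤ semicircle u + semicircle v by linarith)]
  have h3 : |u + v| ≤ 6 / 5 := (abs_add_le u v).trans (by linarith)
  nlinarith [abs_nonneg (u - v), abs_nonneg (semicircle u - semicircle v)]

lemma hasDerivAt_semicircle {u : ℝ} (hu : |u| < 1) :
    HasDerivAt semicircle (-u / semicircle u) u := by
  have h1 : 0 < 1 - u ^ 2 := by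
    have := sq_lt_one_iff_abs_lt_one u |>.2 hu
    linarith
  have h2 : HasDerivAt (fun x : ℝ => 1 - x ^ 2) (-(2 * u)) u := by
    simpa using (hasDerivAt_pow 2 u).const_sub 1
  have h3 := h2.sqrt h1.ne'
  rw [← mul_neg, mul_div_mul_left _ _ two_ne_zero] at h3
  exact h3

/-- The slope of the semicircle decreases at rate at least one. -/
lemma sub_le_slope_sub {x y : ℝ} (hx : |x| < 1) (hy : |y| < 1) (hyx : y ≤ x) :
    x - y ≤ x / semicircle x - y / semicircle y := by
  have key : ∀ w : ℝ, |w| < 1 →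
      0 < semicircle w ∧ semicircle w ≤ 1 ∧ semicircle w ^ 2 = 1 - w ^ 2 := by
    intro w hw
    have h1 : w ^ 2 < 1 := sq_lt_one_iff_abs_lt_one w |>.2 hw
    exact ⟨Real.sqrt_pos.2 (by linarith), Real.sqrt_le_one.2 (by nlinarith [sq_nonneg w]),
      Real.sq_sqrt (by linarith)⟩
  obtain ⟨hX, hX1, hX2⟩ := key x hx
  obtain ⟨hY, hY1, hY2⟩ := key y hy
  set X := semicircle x
  set Y := semicircle y
  have e : x / X - y / Y = (x - y) * ((1 + X * Y + x * y) / ((X + Y) * (X * Y))) := by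
    field_simp
    linear_combination x * hY2 - y * hX2
  rw [e]
  refine le_mul_of_one_le_right (by linarith) ?_
  rw [one_le_div (by positivity)]
  have h1 : X * Y ≤ 1 + x * y := by nlinarith [sq_nonneg (X - Y), sq_nonneg (x + y)]
  have h2 : 0 < X * Y := by positivity
  nlinarith

lemma second_difference_le {u v d : ℝ} (hd : 0 ≤ d) (hvu : v ≤ u) (hu : |u| < 1) (hv : |v| < 1)
    (hvd : |v - d| < 1) :
    semicircle u - semicircle (u - d) - (semicircle v - semicircle (v - d)) ≤ -(d * (u - v)) := by
  rw [abs_lt] at hu hv hvd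
  have hder : ∀ x ∈ Set.Icc v u, HasDerivAt (fun x => semicircle x - semicircle (x - d) + d * x)
      (-x / semicircle x - -(x - d) / semicircle (x - d) + d) x := by
    intro x hx
    have h1 := hasDerivAt_semicircle (u := x) (abs_lt.2 ⟨by linarith [hx.1], by linarith [hx.2]⟩)
    have h2 := hasDerivAt_semicircle (u := x - d)
      (abs_lt.2 ⟨by linarith [hx.1], by linarith [hx.2]⟩)
    have h3 := h2.comp_sub_const x d
    have h4 := (h1.sub h3).add ((hasDerivAt_id x).const_mul d)
    rw [mul_one] at h4
    exact h4
  have hanti : AntitoneOn (fun x => semicircle x - semicircle (x - d) + d * x) (Set.Icc v u) := by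
    refine antitoneOn_of_deriv_nonpos (convex_Icc v u)
      (fun x hx => (hder x hx).continuousAt.continuousWithinAt)
      (fun x hx => (hder x (interior_subset hx)).differentiableAt.differentiableWithinAt) ?_
    intro x hx
    have hx := interior_subset hx
    rw [(hder x hx).deriv]
    have := sub_le_slope_sub (x := x) (y := x - d)
      (abs_lt.2 ⟨by linarith [hx.1], by linarith [hx.2]⟩)
      (abs_lt.2 ⟨by linarith [hx.1], by linarith [hx.2]⟩) (by linarith)
    rw [neg_div, neg_div]
    linarith
  have := hanti (Set.left_mem_Icc.2 hvu) (Set.right_mem_Icc.2 hvu) hvu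
  simp only at this
  linarith

/-- Curvature of the circle: translates by a horizontal shift `d` separate at rate `|d|`. -/
lemma abs_mul_abs_le_second_difference {u v d : ℝ} (hu : |u| < 1) (hv : |v| < 1)
    (hud : |u - d| < 1) (hvd : |v - d| < 1) :
    |d| * |u - v| ≤
      |semicircle u - semicircle (u - d) - (semicircle v - semicircle (v - d))| := by
  wlog hvu : v ≤ u generalizing u v
  · have := this hv hu hvd hud (le_of_not_ge hvu)
    rwa [abs_sub_comm u, abs_sub_comm (semicircle u - semicircle (u - d))]
  rw [← abs_mul]
  rcases le_total 0 d with hd | hd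
  · have := second_difference_le hd hvu hu hv hvd
    rw [abs_of_nonneg (mul_nonneg hd (by linarith))]
    exact le_trans (by linarith) (neg_le_abs _)
  · have := second_difference_le (u := u - d) (v := v - d) (d := -d) (by linarith) (by linarith)
      hud hvd (by simpa using hv)
    simp only [sub_neg_eq_add, sub_add_cancel] at this
    rw [abs_of_nonpos (mul_nonpos_of_nonpos_of_nonneg hd (by linarith))]
    exact le_trans (by linarith) (le_abs_self _)

/-! ### Discretised arcs in a difference set -/

/-- A finite set `T ⊆ ℝ²` whose difference set approximates a `3δ`-separated set of `M` points of
the unit circle with error `δ` in each coordinate: the `j`-th point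
`(3δj, semicircle (3δj))` is close to `b j - a j`. The two bounds on `δ * M` say
that the arc has a length comparable with one and that its first coordinates stay in
`[0, 1/2]`. -/
structure IsDiscreteArc (δ : ℝ) (T : Finset (ℝ × ℝ)) (M : ℕ) (a b : ℕ → ℝ × ℝ) : Prop where
  pos : 0 < δ
  le : δ ≤ 1 / 20
  short : 3 * δ * M ≤ 1 / 2
  long : 1 ≤ 12 * δ * M
  left_mem : ∀ j < M, a j ∈ T
  right_mem : ∀ j < M, b j ∈ T
  fst_close : ∀ j < M, |(b j).1 - (a j).1 - 3 * δ * j| ≤ δ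
  snd_close : ∀ j < M, |(b j).2 - (a j).2 - semicircle (3 * δ * j)| ≤ δ

lemma card_le_of_forall_sub_le {S : Finset ℕ} {R : ℝ} (hR : 0 ≤ R)
    (h : ∀ j ∈ S, ∀ k ∈ S, (j : ℝ) - k ≤ R) : (S.card : ℝ) ≤ R + 1 := by
  rcases S.eq_empty_or_nonempty with rfl | hS
  · simp; linarith
  have h1 : S ⊆ Finset.Icc (S.min' hS) (S.max' hS) := fun j hj =>
    Finset.mem_Icc.2 ⟨S.min'_le j hj, S.le_max' j hj⟩
  have h2 := Finset.card_le_card h1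
  rw [Nat.card_Icc] at h2
  have h3 := h _ (S.max'_mem hS) _ (S.min'_mem hS)
  have h4 : S.card + S.min' hS ≤ S.max' hS + 1 := by
    have := S.min'_le _ (S.max'_mem hS)
    omega
  have h5 : (S.card : ℝ) + S.min' hS ≤ S.max' hS + 1 := by exact_mod_cast h4
  linarith

/-- The paths of length two `a j - b j = b k - a k` formed by pairs of indices in `J`. -/
noncomputable def paths (b : ℕ → ℝ × ℝ) (J : Finset ℕ) : Finset (ℕ × ℕ) :=
  (J ×ˢ J).filter fun p => b p.1 = b p.2

lemma mem_paths {b : ℕ → ℝ × ℝ} {J : Finset ℕ} {p : ℕ × ℕ} :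
    p ∈ paths b J ↔ (p.1 ∈ J ∧ p.2 ∈ J) ∧ b p.1 = b p.2 := by
  simp [paths]

lemma card_sq_le_card_mul_card_paths {T : Finset (ℝ × ℝ)} {b : ℕ → ℝ × ℝ} {J : Finset ℕ}
    (h : ∀ j ∈ J, b j ∈ T) : (J.card : ℝ) ^ 2 ≤ T.card * (paths b J).card := by
  have h1 : J.card = ∑ t ∈ T, (J.filter fun j => b j = t).card :=
    Finset.card_eq_sum_card_fiberwise h
  have h2 : (paths b J).card = ∑ t ∈ T, (J.filter fun j => b j = t).card ^ 2 := by
    rw [Finset.card_eq_sum_card_fiberwise (f := fun p => b p.1) (t := T)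
      (fun p hp => h _ (mem_paths.1 hp).1.1)]
    refine Finset.sum_congr rfl fun t _ => ?_
    rw [sq, ← Finset.card_product]
    congr 1
    ext p
    simp only [Finset.mem_filter, mem_paths, Finset.mem_product]
    grind
  have h3 := sq_sum_le_card_mul_sum_sq (s := T) (f := fun t => (J.filter fun j => b j = t).card)
  rw [← h1, ← h2] at h3
  exact_mod_cast h3

/-- The number of points of `T` within sup-distance `R` of `t`. -/
noncomputable def ballCount (T : Finset (ℝ × ℝ)) (t : ℝ × ℝ) (R : ℝ) : ℕ :=
  (T.filter fun t' => dist t' t ≤ R).card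

lemma ballCount_mono (T : Finset (ℝ × ℝ)) (t : ℝ × ℝ) {R R' : ℝ} (h : R ≤ R') :
    ballCount T t R ≤ ballCount T t R' :=
  Finset.card_le_card (Finset.monotone_filter_right T fun _ _ h' => le_trans h' h)

lemma dist_le_iff_coords {p q : ℝ × ℝ} {R : ℝ} :
    dist p q ≤ R ↔ |p.1 - q.1| ≤ R ∧ |p.2 - q.2| ≤ R := by
  rw [Prod.dist_eq, max_le_iff, Real.dist_eq, Real.dist_eq]

lemma card_eq_sum_card_fiber {T : Finset (ℝ × ℝ)} {a : ℕ → ℝ × ℝ} {S : Finset (ℕ × ℕ)}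
    (h : ∀ p ∈ S, a p.1 ∈ T ∧ a p.2 ∈ T) :
    S.card = ∑ q ∈ T ×ˢ T, (S.filter fun p => (a p.1, a p.2) = q).card :=
  Finset.card_eq_sum_card_fiberwise (f := fun p : ℕ × ℕ => (a p.1, a p.2)) (fun p hp => by
    simpa using h p hp)

namespace IsDiscreteArc

variable {δ : ℝ} {T : Finset (ℝ × ℝ)} {M : ℕ} {a b : ℕ → ℝ × ℝ}

lemma abscissa_mem (h : IsDiscreteArc δ T M a b) {j : ℕ} (hj : j < M) :
    0 ≤ 3 * δ * j ∧ 3 * δ * j ≤ 1 / 2 := by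
  have := h.pos
  have h1 : (j : ℝ) ≤ M := by exact_mod_cast hj.le
  exact ⟨by positivity, le_trans (by gcongr) h.short⟩

lemma abscissa_abs_le (h : IsDiscreteArc δ T M a b) {j : ℕ} (hj : j < M) :
    |3 * δ * j| ≤ 3 / 5 := by
  have := h.abscissa_mem hj
  rw [abs_of_nonneg this.1]; linarith

lemma index_sub_le (h : IsDiscreteArc δ T M a b) {j k : ℕ} {L : ℝ}
    (hL : |3 * δ * j - 3 * δ * k| ≤ L) : (j : ℝ) - k ≤ L / (3 * δ) := by
  have := h.pos
  rw [le_div_iff₀ (by positivity)]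
  have := (abs_le.1 hL).2
  linarith

/-- Distinct indices give distinct pairs of points, since the directions are `3δ`-separated. -/
lemma index_eq (h : IsDiscreteArc δ T M a b) {j k : ℕ} (hj : j < M) (hk : k < M)
    (ha : a j = a k) (hb : b j = b k) : j = k := by
  have hδ := h.pos
  have h1 := abs_le.1 (h.fst_close j hj)
  have h2 := abs_le.1 (h.fst_close k hk)
  rw [ha, hb] at h1
  by_contra hne
  rcases Nat.lt_or_gt_of_ne hne with hlt | hlt
  · have : (j : ℝ) + 1 ≤ k := by exact_mod_cast hlt
    nlinarith
  · have : (k : ℝ) + 1 ≤ j := by exact_mod_cast hlt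
    nlinarith

lemma card_le_sq (h : IsDiscreteArc δ T M a b) : (M : ℝ) ≤ (T.card : ℝ) ^ 2 := by
  have h1 : (Finset.range M).card ≤ (T ×ˢ T).card := by
    refine Finset.card_le_card_of_injOn (fun j => (a j, b j)) ?_ ?_
    · intro j hj
      have hj : j < M := by simpa using hj
      simpa using ⟨h.left_mem j hj, h.right_mem j hj⟩
    · intro j hj k hk hjk
      simp only [Prod.mk.injEq] at hjk
      exact h.index_eq (by simpa using hj) (by simpa using hk) hjk.1 hjk.2
  rw [Finset.card_range, Finset.card_product] at h1
  rw [sq]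
  exact_mod_cast h1

lemma abs_fst_sub_sub_le (h : IsDiscreteArc δ T M a b) {j k : ℕ} (hj : j < M) (hk : k < M)
    (hb : b j = b k) : |3 * δ * j - 3 * δ * k - ((a k).1 - (a j).1)| ≤ 2 * δ := by
  have h1 := abs_le.1 (h.fst_close j hj)
  have h2 := abs_le.1 (h.fst_close k hk)
  rw [hb] at h1
  rw [abs_le]; constructor <;> linarith

lemma abs_snd_sub_sub_le (h : IsDiscreteArc δ T M a b) {j k : ℕ} (hj : j < M) (hk : k < M)
    (hb : b j = b k) :
    |semicircle (3 * δ * j) - semicircle (3 * δ * k) - ((a k).2 - (a j).2)| ≤ 2 * δ := by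
  have h1 := abs_le.1 (h.snd_close j hj)
  have h2 := abs_le.1 (h.snd_close k hk)
  rw [hb] at h1
  rw [abs_le]; constructor <;> linarith

/-- Two unit circles whose centres are `D` apart horizontally have all their common `δ`-approximate
points in a set of diameter `O(δ / D)`. -/
lemma curvature (h : IsDiscreteArc δ T M a b) {j k j' k' : ℕ} (hj : j < M) (hk : k < M)
    (hj' : j' < M) (hk' : k' < M) (hb : b j = b k) (hb' : b j' = b k') (haj : a j = a j')
    (hak : a k = a k') :
    |(a j).1 - (a k).1| * |3 * δ * j - 3 * δ * j'| ≤ 8 * δ := by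
  have hδ := h.pos
  have hle := h.le
  set d := (a k).1 - (a j).1 with hd
  have f1 := h.abs_fst_sub_sub_le hj hk hb
  have f2 := h.abs_fst_sub_sub_le hj' hk' hb'
  have s1 := h.abs_snd_sub_sub_le hj hk hb
  have s2 := h.abs_snd_sub_sub_le hj' hk' hb'
  rw [← haj, ← hak, ← hd] at f2
  rw [← haj, ← hak] at s2
  rw [← hd] at f1
  have m1 := h.abscissa_mem hj
  have m2 := h.abscissa_mem hk
  have m3 := h.abscissa_mem hj'
  have m4 := h.abscissa_mem hk'
  set u := 3 * δ * (j : ℝ)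
  set u' := 3 * δ * (k : ℝ)
  set v := 3 * δ * (j' : ℝ)
  set v' := 3 * δ * (k' : ℝ)
  have f1' := abs_le.1 f1
  have f2' := abs_le.1 f2
  have bu : |u - d| ≤ 3 / 5 := abs_le.2 ⟨by linarith, by linarith⟩
  have bv : |v - d| ≤ 3 / 5 := abs_le.2 ⟨by linarith, by linarith⟩
  have bu' : |u'| ≤ 3 / 5 := abs_le.2 ⟨by linarith, by linarith⟩
  have bv' : |v'| ≤ 3 / 5 := abs_le.2 ⟨by linarith, by linarith⟩
  have e1 := abs_semicircle_sub_le bu bu'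
  have e2 := abs_semicircle_sub_le bv bv'
  rw [show u - d - u' = u - u' - d by ring] at e1
  rw [show v - d - v' = v - v' - d by ring] at e2
  have key := abs_mul_abs_le_second_difference (u := u) (v := v) (d := d)
    (abs_lt.2 ⟨by linarith, by linarith⟩) (abs_lt.2 ⟨by linarith, by linarith⟩)
    (by linarith) (by linarith)
  rw [abs_sub_comm]
  refine key.trans ?_
  have e1' := abs_le.1 (e1.trans f1)
  have e2' := abs_le.1 (e2.trans f2)
  have s1' := abs_le.1 s1
  have s2' := abs_le.1 s2
  rw [abs_le]; constructor <;> linarith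

/-- Paths with nearby left endpoints are few because the directions are separated. -/
lemma card_paths_near_le (h : IsDiscreteArc δ T M a b) {J : Finset ℕ} (hJ : ∀ j ∈ J, j < M)
    {η : ℝ} (hη : 0 ≤ η) :
    (((paths b J).filter fun p => |(a p.1).1 - (a p.2).1| < η).card : ℝ)
      ≤ J.card * (η / δ + 3) := by
  have hδ := h.pos
  set S := (paths b J).filter fun p => |(a p.1).1 - (a p.2).1| < η with hS
  have h1 : S.card = ∑ j ∈ J, (S.filter fun p => p.1 = j).card :=
    Finset.card_eq_sum_card_fiberwise fun p hp =>
      (mem_paths.1 (Finset.mem_filter.1 hp).1).1.1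
  rw [h1, Nat.cast_sum, ← nsmul_eq_mul]
  refine Finset.sum_le_card_nsmul _ _ _ fun j hj => ?_
  have hinj : (S.filter fun p => p.1 = j).card
      = ((S.filter fun p => p.1 = j).image Prod.snd).card := by
    refine (Finset.card_image_of_injOn ?_).symm
    intro p hp q hq hpq
    simp only [Finset.coe_filter, Set.mem_ofPred_eq] at hp hq
    exact Prod.ext (hp.2.trans hq.2.symm) hpq
  rw [hinj]
  have hclose : ∀ k ∈ (S.filter fun p => p.1 = j).image Prod.snd,
      |3 * δ * j - 3 * δ * k| ≤ η + 2 * δ := by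
    intro k hk
    simp only [Finset.mem_image, Finset.mem_filter, hS, mem_paths] at hk
    obtain ⟨p, ⟨⟨⟨⟨hp1, hp2⟩, hb⟩, hD⟩, rfl⟩, rfl⟩ := hk
    have := abs_le.1 (h.abs_fst_sub_sub_le (hJ _ hp1) (hJ _ hp2) hb)
    have hD := abs_lt.1 hD
    rw [abs_le]; constructor <;> linarith
  refine (card_le_of_forall_sub_le (R := (2 * (η + 2 * δ)) / (3 * δ)) (by positivity)
    fun k hk k' hk' => h.index_sub_le ?_).trans ?_
  · have := abs_le.1 (hclose k hk)
    have := abs_le.1 (hclose k' hk')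
    rw [abs_le]; constructor <;> linarith
  · have : 2 * (η + 2 * δ) / (3 * δ) = 2 / 3 * (η / δ) + 4 / 3 := by field_simp; ring
    rw [this]
    have : 0 ≤ η / δ := by positivity
    linarith

/-- For fixed left endpoints `q`, a path is determined by its first index. -/
lemma card_fiber_eq (h : IsDiscreteArc δ T M a b) {J : Finset ℕ} (hJ : ∀ j ∈ J, j < M)
    {S : Finset (ℕ × ℕ)} (hS : S ⊆ paths b J) (q : (ℝ × ℝ) × (ℝ × ℝ)) :
    (S.filter fun p => (a p.1, a p.2) = q).card
      = ((S.filter fun p => (a p.1, a p.2) = q).image Prod.fst).card := by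
  refine (Finset.card_image_of_injOn ?_).symm
  intro p hp p' hp' hpp
  simp only [Finset.coe_filter, Set.mem_ofPred_eq] at hp hp'
  have h1 := mem_paths.1 (hS hp.1)
  have h2 := mem_paths.1 (hS hp'.1)
  refine Prod.ext hpp (h.index_eq (hJ _ h1.1.2) (hJ _ h2.1.2) ?_ ?_)
  · exact (Prod.ext_iff.1 (hp.2.trans hp'.2.symm)).2
  · rw [← h1.2, ← h2.2, show p.1 = p'.1 from hpp]

lemma paths_curvature (h : IsDiscreteArc δ T M a b) {J : Finset ℕ} (hJ : ∀ j ∈ J, j < M)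
    {p p' : ℕ × ℕ} (hp : p ∈ paths b J) (hp' : p' ∈ paths b J)
    (ha : (a p.1, a p.2) = (a p'.1, a p'.2)) {D : ℝ} (hD : 0 < D)
    (hpD : D ≤ |(a p.1).1 - (a p.2).1|) :
    |3 * δ * p.1 - 3 * δ * p'.1| ≤ 8 * δ / D := by
  rw [mem_paths] at hp hp'
  rw [Prod.ext_iff] at ha
  have := h.curvature (hJ _ hp.1.1) (hJ _ hp.1.2) (hJ _ hp'.1.1) (hJ _ hp'.1.2) hp.2 hp'.2
    ha.1 ha.2
  rw [le_div_iff₀ hD, mul_comm]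
  exact le_trans (by gcongr) this

lemma card_paths_far_le (h : IsDiscreteArc δ T M a b) {J : Finset ℕ} (hJ : ∀ j ∈ J, j < M)
    {τ : ℝ} (hτ : 0 < τ) (hτ1 : τ ≤ 1) :
    (((paths b J).filter fun p => τ ≤ |(a p.1).1 - (a p.2).1|).card : ℝ)
      ≤ (T.card : ℝ) ^ 2 * (4 / τ) := by
  have hδ := h.pos
  set S := (paths b J).filter fun p => τ ≤ |(a p.1).1 - (a p.2).1| with hS
  have hSp : S ⊆ paths b J := Finset.filter_subset _ _
  rw [card_eq_sum_card_fiber (S := S) (T := T) (a := a) fun p hp =>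
    have h1 := mem_paths.1 (hSp hp)
    ⟨h.left_mem _ (hJ _ h1.1.1), h.left_mem _ (hJ _ h1.1.2)⟩, Nat.cast_sum, sq,
    ← Nat.cast_mul, ← Finset.card_product, ← nsmul_eq_mul]
  refine Finset.sum_le_card_nsmul _ _ _ fun q _ => ?_
  rw [h.card_fiber_eq hJ hSp]
  refine (card_le_of_forall_sub_le (R := (8 * δ / τ) / (3 * δ)) (by positivity)
    fun k hk k' hk' => h.index_sub_le ?_).trans ?_
  · simp only [Finset.mem_image, Finset.mem_filter, hS] at hk hk'
    obtain ⟨p, ⟨⟨hp, hpD⟩, hpq⟩, rfl⟩ := hk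
    obtain ⟨p', ⟨⟨hp', -⟩, hpq'⟩, rfl⟩ := hk'
    exact h.paths_curvature hJ hp hp' (hpq.trans hpq'.symm) hτ hpD
  · have h1 : 8 * δ / τ / (3 * δ) = 8 / 3 / τ := by field_simp
    have h2 : 1 ≤ 1 / τ := by rw [le_div_iff₀ hτ]; linarith
    rw [h1, show 8 / 3 / τ = 8 / 3 * (1 / τ) by ring, show 4 / τ = 4 * (1 / τ) by ring]
    linarith

/-- Paths whose left endpoints have horizontal distance between `lo` and `hi`: the second
left endpoint is within `hi + 4δ` of the first one, and by curvature all the middle points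
belonging to given left endpoints are within `8δ / lo + 2δ` of each other. -/
lemma card_paths_scale_le (h : IsDiscreteArc δ T M a b) {J : Finset ℕ} (hJ : ∀ j ∈ J, j < M)
    {lo hi Λ : ℝ} (hlo : 0 < lo) (hhi : 0 ≤ hi) (hΛ0 : 0 ≤ Λ)
    (hΛ : ∀ j ∈ J, (ballCount T (a j) (hi + 4 * δ) : ℝ)
      * ballCount T (b j) (8 * δ / lo + 2 * δ) ≤ Λ) :
    (((paths b J).filter fun p => lo ≤ |(a p.1).1 - (a p.2).1| ∧
      |(a p.1).1 - (a p.2).1| < hi).card : ℝ) ≤ T.card * Λ := by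
  have hδ := h.pos
  set S := (paths b J).filter fun p => lo ≤ |(a p.1).1 - (a p.2).1| ∧
      |(a p.1).1 - (a p.2).1| < hi with hS
  have hSp : S ⊆ paths b J := Finset.filter_subset _ _
  rw [card_eq_sum_card_fiber (S := S) (T := T) (a := a) fun p hp =>
    have h1 := mem_paths.1 (hSp hp)
    ⟨h.left_mem _ (hJ _ h1.1.1), h.left_mem _ (hJ _ h1.1.2)⟩, Nat.cast_sum, Finset.sum_product,
    ← nsmul_eq_mul]
  refine Finset.sum_le_card_nsmul _ _ _ fun x hx => ?_
  -- every nonempty fibre over `(x, y)` has `y` near `x` and size at most `Λ / ballCount T x _`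
  have hpos : 0 < (ballCount T x (hi + 4 * δ) : ℝ) := by
    exact_mod_cast Finset.card_pos.2 ⟨x, by simpa [hx] using (by positivity : 0 ≤ hi + 4 * δ)⟩
  have hfib : ∀ y ∈ T, (S.filter fun p => (a p.1, a p.2) = (x, y)).Nonempty →
      dist y x ≤ hi + 4 * δ ∧ (ballCount T x (hi + 4 * δ) : ℝ) *
        (S.filter fun p => (a p.1, a p.2) = (x, y)).card ≤ Λ := by
    rintro y hy ⟨p, hp⟩
    simp only [Finset.mem_filter, Prod.mk.injEq, hS] at hp
    obtain ⟨⟨hpp, hplo, hphi⟩, rfl, rfl⟩ := hp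
    have hp := mem_paths.1 hpp
    constructor
    · have f := h.abs_fst_sub_sub_le (hJ _ hp.1.1) (hJ _ hp.1.2) hp.2
      have s := h.abs_snd_sub_sub_le (hJ _ hp.1.1) (hJ _ hp.1.2) hp.2
      have e := abs_semicircle_sub_le (h.abscissa_abs_le (hJ _ hp.1.1))
        (h.abscissa_abs_le (hJ _ hp.1.2))
      have hD := abs_lt.1 hphi
      have f := abs_le.1 f
      have s := abs_le.1 s
      have e' : |3 * δ * p.1 - 3 * δ * p.2| ≤ hi + 2 * δ :=
        abs_le.2 ⟨by linarith, by linarith⟩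
      have e := abs_le.1 (e.trans e')
      rw [dist_le_iff_coords]
      exact ⟨abs_le.2 ⟨by linarith, by linarith⟩, abs_le.2 ⟨by linarith, by linarith⟩⟩
    · refine le_trans ?_ (hΛ p.1 hp.1.1)
      gcongr
      rw [h.card_fiber_eq hJ hSp]
      refine Finset.card_le_card_of_injOn b ?_ ?_
      · intro j hj
        simp only [Finset.coe_image, Set.mem_image, Finset.coe_filter, Set.mem_ofPred_eq, hS,
          Finset.mem_filter] at hj
        obtain ⟨p', ⟨⟨hpp', -⟩, hpq'⟩, rfl⟩ := hj
        have hp' := mem_paths.1 hpp'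
        have c := h.paths_curvature hJ hpp hpp' hpq'.symm hlo hplo
        have e := abs_semicircle_sub_le (h.abscissa_abs_le (hJ _ hp.1.1))
          (h.abscissa_abs_le (hJ _ hp'.1.1))
        have e := abs_le.1 (e.trans c)
        have c := abs_le.1 c
        have f1 := abs_le.1 (h.fst_close _ (hJ _ hp.1.1))
        have f2 := abs_le.1 (h.fst_close _ (hJ _ hp'.1.1))
        have s1 := abs_le.1 (h.snd_close _ (hJ _ hp.1.1))
        have s2 := abs_le.1 (h.snd_close _ (hJ _ hp'.1.1))
        have ha : a p'.1 = a p.1 := (Prod.ext_iff.1 hpq').1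
        rw [ha] at f2 s2
        simp only [Finset.coe_filter, Set.mem_ofPred_eq]
        refine ⟨h.right_mem _ (hJ _ hp'.1.1), dist_le_iff_coords.2 ⟨?_, ?_⟩⟩
        · exact abs_le.2 ⟨by linarith, by linarith⟩
        · exact abs_le.2 ⟨by linarith, by linarith⟩
      · intro j hj j' hj' hjj
        simp only [Finset.coe_image, Set.mem_image, Finset.coe_filter, Set.mem_ofPred_eq] at hj hj'
        obtain ⟨p', ⟨hpp', hpq'⟩, rfl⟩ := hj
        obtain ⟨p'', ⟨hpp'', hpq''⟩, rfl⟩ := hj'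
        refine h.index_eq (hJ _ (mem_paths.1 (hSp hpp')).1.1) (hJ _ (mem_paths.1 (hSp hpp'')).1.1)
          ?_ hjj
        exact (Prod.ext_iff.1 (hpq'.trans hpq''.symm)).1
  have hterm : ∀ y ∈ T, ((S.filter fun p => (a p.1, a p.2) = (x, y)).card : ℝ) ≤
      if dist y x ≤ hi + 4 * δ then Λ / ballCount T x (hi + 4 * δ) else 0 := by
    intro y hy
    rcases (S.filter fun p => (a p.1, a p.2) = (x, y)).eq_empty_or_nonempty with hemp | hne
    · rw [hemp, Finset.card_empty, Nat.cast_zero]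
      split_ifs
      · positivity
      · exact le_rfl
    · obtain ⟨h1, h2⟩ := hfib y hy hne
      rw [if_pos h1, le_div_iff₀ hpos, mul_comm]
      exact h2
  refine (Finset.sum_le_sum hterm).trans_eq ?_
  rw [← Finset.sum_filter, Finset.sum_const, nsmul_eq_mul]
  exact mul_div_cancel₀ _ hpos.ne'

/-- Few indices have both endpoints in crowded balls: the left-hand side counts triples of an
index and two points of `T` within `5τ` of its endpoints, and two given balls of radius `5τ`
realise only `O(τ / δ)` of the separated directions. -/
lemma sum_ballCount_mul_ballCount_le (h : IsDiscreteArc δ T M a b) {τ : ℝ} (hτ : δ ≤ τ) :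
    ∑ j ∈ Finset.range M, (ballCount T (a j) (5 * τ) : ℝ) * ballCount T (b j) (5 * τ)
      ≤ (T.card : ℝ) ^ 2 * (9 * τ / δ) := by
  have hδ := h.pos
  have hτ0 : 0 < τ := hδ.trans_le hτ
  have h1 : ∀ j, ballCount T (a j) (5 * τ) * ballCount T (b j) (5 * τ)
      = ∑ q ∈ T ×ˢ T, if dist q.1 (a j) ≤ 5 * τ ∧ dist q.2 (b j) ≤ 5 * τ then 1 else 0 := by
    intro j
    rw [ballCount, ballCount, ← Finset.card_product, ← Finset.card_filter]
    congr 1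
    ext q
    simp only [Finset.mem_product, Finset.mem_filter]
    tauto
  have h2 : ∑ j ∈ Finset.range M, (ballCount T (a j) (5 * τ)) * ballCount T (b j) (5 * τ)
      = ∑ q ∈ T ×ˢ T, ((Finset.range M).filter fun j =>
          dist q.1 (a j) ≤ 5 * τ ∧ dist q.2 (b j) ≤ 5 * τ).card := by
    simp_rw [h1]
    rw [Finset.sum_comm]
    simp_rw [Finset.card_filter]
  have h3 : ∑ j ∈ Finset.range M, (ballCount T (a j) (5 * τ) : ℝ) * ballCount T (b j) (5 * τ)
      = ∑ q ∈ T ×ˢ T, (((Finset.range M).filter fun j =>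
          dist q.1 (a j) ≤ 5 * τ ∧ dist q.2 (b j) ≤ 5 * τ).card : ℝ) := by
    exact_mod_cast h2
  rw [h3, sq, ← Nat.cast_mul, ← Finset.card_product, ← nsmul_eq_mul]
  refine Finset.sum_le_card_nsmul _ _ _ fun q _ => ?_
  have hclose : ∀ j ∈ (Finset.range M).filter fun j =>
      dist q.1 (a j) ≤ 5 * τ ∧ dist q.2 (b j) ≤ 5 * τ,
      |3 * δ * j - (q.2.1 - q.1.1)| ≤ 11 * τ := by
    intro j hj
    simp only [Finset.mem_filter, Finset.mem_range, dist_le_iff_coords] at hj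
    have f := abs_le.1 (h.fst_close j hj.1)
    have h1 := abs_le.1 hj.2.1.1
    have h2 := abs_le.1 hj.2.2.1
    rw [abs_le]; constructor <;> linarith
  refine (card_le_of_forall_sub_le (R := 22 * τ / (3 * δ)) (by positivity)
    fun k hk k' hk' => h.index_sub_le ?_).trans ?_
  · have := abs_le.1 (hclose k hk)
    have := abs_le.1 (hclose k' hk')
    rw [abs_le]; constructor <;> linarith
  · have h1 : 22 * τ / (3 * δ) = 22 / 3 * (τ / δ) := by field_simp
    have h2 : 1 ≤ τ / δ := by rw [le_div_iff₀ hδ]; linarith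
    rw [h1, show 9 * τ / δ = 9 * (τ / δ) by ring]
    linarith

lemma card_pos (h : IsDiscreteArc δ T M a b) : 0 < M ∧ 0 < T.card := by
  have hM : 0 < M := by
    rcases Nat.eq_zero_or_pos M with rfl | h0
    · have := h.long
      norm_num at this
    · exact h0
  exact ⟨hM, Finset.card_pos.2 ⟨_, h.left_mem 0 hM⟩⟩

/-- At least half of the indices avoid crowded pairs of balls. -/
lemma exists_sparse_indices (h : IsDiscreteArc δ T M a b) {τ : ℝ} (hτ : δ ≤ τ) :
    ∃ J ⊆ Finset.range M, (M : ℝ) / 2 ≤ J.card ∧ ∀ j ∈ J,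
      (ballCount T (a j) (5 * τ) : ℝ) * ballCount T (b j) (5 * τ)
        ≤ 216 * (T.card : ℝ) ^ 2 * τ := by
  have hδ := h.pos
  have hτ0 : 0 < τ := hδ.trans_le hτ
  obtain ⟨hM, hN⟩ := h.card_pos
  set w : ℕ → ℝ := fun j => (ballCount T (a j) (5 * τ) : ℝ) * ballCount T (b j) (5 * τ) with hw
  set lam := 216 * (T.card : ℝ) ^ 2 * τ with hlam
  have hN' : (0 : ℝ) < T.card := by exact_mod_cast hN
  have hlam0 : 0 < lam := by positivity
  refine ⟨(Finset.range M).filter fun j => w j ≤ lam, Finset.filter_subset _ _, ?_,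
    fun j hj => (Finset.mem_filter.1 hj).2⟩
  have h1 := Finset.card_filter_add_card_filter_not (s := Finset.range M) (fun j => w j ≤ lam)
  have h2 : (((Finset.range M).filter fun j => ¬ w j ≤ lam).card : ℝ) * lam
      ≤ ∑ j ∈ Finset.range M, w j := by
    rw [← nsmul_eq_mul]
    refine (Finset.card_nsmul_le_sum _ w lam fun j hj => ?_).trans
      (Finset.sum_le_sum_of_subset_of_nonneg (Finset.filter_subset _ _) fun j _ _ => by positivity)
    exact (not_le.1 (Finset.mem_filter.1 hj).2).le
  have h3 := h2.trans (h.sum_ballCount_mul_ballCount_le hτ)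
  have h4 : (T.card : ℝ) ^ 2 * (9 * τ / δ) ≤ M / 2 * lam := by
    rw [hlam, mul_div_assoc', div_le_iff₀ hδ]
    have := mul_le_mul_of_nonneg_left h.long (show 0 ≤ 9 * (T.card : ℝ) ^ 2 * τ by positivity)
    linarith
  have h5 := le_of_mul_le_mul_right (h3.trans h4) hlam0
  rw [Finset.card_range] at h1
  have h6 : (((Finset.range M).filter fun j => w j ≤ lam).card : ℝ)
      + ((Finset.range M).filter fun j => ¬ w j ≤ lam).card = M := by exact_mod_cast h1
  linarith

/-- The incidence bound behind the exponent `4 / 7`. The scale `τ = |T| ^ (-1/2)` balances the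
contributions of far and of intermediate paths. -/
lemma sq_le_card_rpow (h : IsDiscreteArc δ T M a b) :
    (M : ℝ) ^ 2 ≤ 924 * (T.card : ℝ) ^ (7 / 2 : ℝ) := by
  have hδ := h.pos
  obtain ⟨hM, hN⟩ := h.card_pos
  have hN1 : (1 : ℝ) ≤ T.card := by exact_mod_cast hN
  obtain ⟨q, hq1, hqN⟩ : ∃ q : ℝ, 1 ≤ q ∧ (T.card : ℝ) = q ^ 2 :=
    ⟨√T.card, Real.one_le_sqrt.2 hN1, (Real.sq_sqrt (by positivity)).symm⟩
  have hq0 : 0 < q := by linarith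
  have hpow : (T.card : ℝ) ^ (7 / 2 : ℝ) = q ^ 7 := by
    rw [hqN, ← Real.rpow_natCast, ← Real.rpow_natCast, ← Real.rpow_mul hq0.le]
    norm_num
  rw [hpow]
  have hMN := h.card_le_sq
  rw [hqN] at hMN
  by_cases hτ : δ ≤ 1 / q
  · set τ := 1 / q with hτdef
    have hτ0 : 0 < τ := by positivity
    have hτ1 : τ ≤ 1 := by rw [hτdef, div_le_one (by positivity)]; exact hq1
    have hqτ : q * τ = 1 := by rw [hτdef]; field_simp
    obtain ⟨J, hJM, hJcard, hJ⟩ := h.exists_sparse_indices hτ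
    have hJ' : ∀ j ∈ J, j < M := fun j hj => Finset.mem_range.1 (hJM hj)
    set η := 8 * δ / τ with hη
    have hη0 : 0 < η := by positivity
    have hnear := h.card_paths_near_le hJ' hη0.le
    have hfar := h.card_paths_far_le hJ' hτ0 hτ1
    have hmid := h.card_paths_scale_le (hi := τ) (Λ := 216 * (T.card : ℝ) ^ 2 * τ) hJ' hη0 hτ0.le
      (by positivity) (fun j hj => by
        refine le_trans ?_ (hJ j hj)
        have e : 8 * δ / η = τ := by rw [hη]; field_simp
        gcongr
        · exact ballCount_mono _ _ (by linarith)
        · exact ballCount_mono _ _ (by rw [e]; linarith))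
    have hsplit : (paths b J).card ≤
        ((paths b J).filter fun p => |(a p.1).1 - (a p.2).1| < η).card
        + ((paths b J).filter fun p => τ ≤ |(a p.1).1 - (a p.2).1|).card
        + ((paths b J).filter fun p => η ≤ |(a p.1).1 - (a p.2).1| ∧
            |(a p.1).1 - (a p.2).1| < τ).card := by
      refine le_trans (Finset.card_le_card ?_)
        ((Finset.card_union_le _ _).trans (Nat.add_le_add_right (Finset.card_union_le _ _) _))
      intro p hp
      simp only [Finset.mem_union, Finset.mem_filter, hp, true_and]
      rcases lt_or_ge |(a p.1).1 - (a p.2).1| η with h1 | h1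
      · exact Or.inl (Or.inl h1)
      · rcases lt_or_ge |(a p.1).1 - (a p.2).1| τ with h2 | h2
        · exact Or.inr ⟨h1, h2⟩
        · exact Or.inl (Or.inr h2)
    have hsplit' := (Nat.cast_le (α := ℝ)).2 hsplit
    push_cast at hsplit'
    have hcs := card_sq_le_card_mul_card_paths (T := T) (b := b) (J := J)
      fun j hj => h.right_mem j (hJ' j hj)
    have hJle : (J.card : ℝ) ≤ q ^ 4 := by
      have : J.card ≤ M := by simpa using Finset.card_le_card hJM
      have : (J.card : ℝ) ≤ M := by exact_mod_cast this
      linarith [show (q ^ 2) ^ 2 = q ^ 4 by ring]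
    have e1 : η / δ + 3 ≤ 11 * q := by
      have : η / δ = 8 * q := by rw [hη, hτdef]; field_simp
      linarith
    have e2 : (T.card : ℝ) ^ 2 * (4 / τ) = 4 * q ^ 5 := by
      rw [hqN, hτdef]; field_simp
    have e3 : (T.card : ℝ) * (216 * (T.card : ℝ) ^ 2 * τ) = 216 * q ^ 5 := by
      rw [hqN, hτdef]; field_simp
    rw [e2] at hfar
    rw [e3] at hmid
    have hnear' : (((paths b J).filter fun p => |(a p.1).1 - (a p.2).1| < η).card : ℝ)
        ≤ 11 * q ^ 5 := by
      refine hnear.trans ((mul_le_mul hJle e1 (by positivity) (by positivity)).trans_eq (by ring))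
    have hP : ((paths b J).card : ℝ) ≤ 231 * q ^ 5 := by linarith
    have h1 : (J.card : ℝ) ^ 2 ≤ q ^ 2 * (231 * q ^ 5) := by
      rw [hqN] at hcs
      exact hcs.trans (by gcongr)
    have h2 : ((M : ℝ) / 2) ^ 2 ≤ (J.card : ℝ) ^ 2 := by gcongr
    nlinarith
  · -- here `|T| > δ⁻²`, and `M ≤ 1 / (6δ)` is enough
    push Not at hτ
    have h1 : 1 < δ * q := by rwa [div_lt_iff₀ (by positivity)] at hτ
    have h2 : (M : ℝ) ≤ q := by
      have h3 := h.short
      have hM0 : (0 : ℝ) < M := by exact_mod_cast hM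
      by_contra hlt
      push Not at hlt
      nlinarith
    calc (M : ℝ) ^ 2 ≤ q ^ 2 := by gcongr
      _ ≤ q ^ 7 := pow_le_pow_right₀ hq1 (by norm_num)
      _ ≤ 924 * q ^ 7 := by linarith [pow_pos (by positivity : 0 < q) 7]

/-- The incidence bound behind the exponent `2 / 3`: if balls of radius `R` around the
endpoints contain at most `C (R / δ) ^ s` points of `T`, then every dyadic scale contributes
at most `C ^ 2 (60 / δ) ^ s` paths per point. -/
lemma sq_le_of_ballCount_le {m : ℕ} (h : IsDiscreteArc ((2 : ℝ)⁻¹ ^ m) T M a b) {C s : ℝ}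
    (hC : 0 ≤ C)
    (ha : ∀ j < M, ∀ R, (2 : ℝ)⁻¹ ^ m ≤ R →
      (ballCount T (a j) R : ℝ) ≤ C * (R / (2 : ℝ)⁻¹ ^ m) ^ s)
    (hb : ∀ j < M, ∀ R, (2 : ℝ)⁻¹ ^ m ≤ R →
      (ballCount T (b j) R : ℝ) ≤ C * (R / (2 : ℝ)⁻¹ ^ m) ^ s) :
    (M : ℝ) ^ 2 ≤ T.card * (4 * M + m * (T.card * (C ^ 2 * (60 * 2 ^ m) ^ s))) := by
  set δ : ℝ := (2 : ℝ)⁻¹ ^ m with hδdef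
  have hδ := h.pos
  have hδ2 : δ * 2 ^ m = 1 := by rw [hδdef, ← mul_pow]; norm_num
  set J := Finset.range M with hJdef
  have hJ : ∀ j ∈ J, j < M := fun j hj => Finset.mem_range.1 hj
  have hcs := card_sq_le_card_mul_card_paths (T := T) (b := b) (J := J)
      fun j hj => h.right_mem j (hJ j hj)
  rw [Finset.card_range] at hcs
  refine hcs.trans (mul_le_mul_of_nonneg_left ?_ (by positivity))
  have hnear := h.card_paths_near_le hJ hδ.le
  rw [Finset.card_range, div_self hδ.ne'] at hnear
  have hscale : ∀ i ∈ Finset.range m, (((paths b J).filter fun p =>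
      2 ^ i * δ ≤ |(a p.1).1 - (a p.2).1| ∧ |(a p.1).1 - (a p.2).1| < 2 ^ (i + 1) * δ).card : ℝ)
      ≤ T.card * (C ^ 2 * (60 * 2 ^ m) ^ s) := by
    intro i hi
    have hpi : (1 : ℝ) ≤ 2 ^ i := one_le_pow₀ (by norm_num)
    have him : (2 : ℝ) ^ i * δ ≤ 1 := by
      rw [← hδ2, mul_comm]
      gcongr
      · norm_num
      · exact (Finset.mem_range.1 hi).le
    refine h.card_paths_scale_le hJ (by positivity) (by positivity) (by positivity) fun j hj => ?_
    have hA : (ballCount T (a j) (2 ^ (i + 1) * δ + 4 * δ) : ℝ) ≤ C * (6 * 2 ^ i) ^ s := by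
      have h1 : 2 ^ (i + 1) * δ + 4 * δ ≤ 6 * 2 ^ i * δ := by
        rw [pow_succ]; nlinarith
      have h2 := ha j (hJ j hj) (6 * 2 ^ i * δ) (by nlinarith)
      rw [mul_div_assoc, div_self hδ.ne', mul_one] at h2
      exact le_trans (by exact_mod_cast ballCount_mono _ _ h1) h2
    have hB : (ballCount T (b j) (8 * δ / (2 ^ i * δ) + 2 * δ) : ℝ)
        ≤ C * (10 / 2 ^ i * 2 ^ m) ^ s := by
      have h0 : δ ≤ 1 / 2 ^ i := by
        rw [le_div_iff₀ (by positivity)]; linarith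
      have h1 : 8 * δ / (2 ^ i * δ) + 2 * δ ≤ 10 / 2 ^ i := by
        have e : 8 * δ / (2 ^ i * δ) = 8 * (1 / 2 ^ i) := by field_simp
        rw [e, show (10 : ℝ) / 2 ^ i = 10 * (1 / 2 ^ i) by ring]
        linarith
      have h2 := hb j (hJ j hj) (10 / 2 ^ i) (by
        rw [show (10 : ℝ) / 2 ^ i = 10 * (1 / 2 ^ i) by ring]; linarith)
      have e : 10 / 2 ^ i / δ = 10 / 2 ^ i * 2 ^ m := by
        rw [div_eq_iff hδ.ne', mul_assoc, mul_comm _ δ, hδ2, mul_one]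
      rw [e] at h2
      exact le_trans (by exact_mod_cast ballCount_mono _ _ h1) h2
    calc _ ≤ (C * (6 * 2 ^ i) ^ s) * (C * (10 / 2 ^ i * 2 ^ m) ^ s) := by gcongr
      _ = C ^ 2 * ((6 * 2 ^ i) ^ s * (10 / 2 ^ i * 2 ^ m) ^ s) := by ring
      _ = C ^ 2 * (60 * 2 ^ m) ^ s := by
          rw [← Real.mul_rpow (by positivity) (by positivity)]
          congr 2
          field_simp
          norm_num
  have hcover : paths b J ⊆ ((paths b J).filter fun p => |(a p.1).1 - (a p.2).1| < δ) ∪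
      (Finset.range m).biUnion fun i => (paths b J).filter fun p =>
        2 ^ i * δ ≤ |(a p.1).1 - (a p.2).1| ∧ |(a p.1).1 - (a p.2).1| < 2 ^ (i + 1) * δ := by
    intro p hp
    simp only [Finset.mem_union, Finset.mem_filter, Finset.mem_biUnion, hp, true_and]
    rcases lt_or_ge |(a p.1).1 - (a p.2).1| δ with h1 | h1
    · exact Or.inl h1
    · right
      have hp' := mem_paths.1 hp
      have hD1 : |(a p.1).1 - (a p.2).1| < 1 := by
        have f := abs_le.1 (h.abs_fst_sub_sub_le (hJ _ hp'.1.1) (hJ _ hp'.1.2) hp'.2)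
        have m1 := h.abscissa_mem (hJ _ hp'.1.1)
        have m2 := h.abscissa_mem (hJ _ hp'.1.2)
        have := h.le
        rw [abs_lt]; constructor <;> linarith
      obtain ⟨i, hi1, hi2⟩ := exists_nat_pow_near (x := |(a p.1).1 - (a p.2).1| / δ) (y := (2 : ℝ))
        (by rwa [one_le_div hδ]) (by norm_num)
      rw [le_div_iff₀ hδ] at hi1
      rw [div_lt_iff₀ hδ] at hi2
      refine ⟨i, Finset.mem_range.2 ?_, hi1, hi2⟩
      have h3 : (2 : ℝ) ^ i * δ < 2 ^ m * δ := by rw [mul_comm _ δ, mul_comm _ δ, hδ2]; linarith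
      exact (pow_lt_pow_iff_right₀ (by norm_num : (1 : ℝ) < 2)).1 (lt_of_mul_lt_mul_right h3 hδ.le)
  have hcard := (Finset.card_le_card hcover).trans ((Finset.card_union_le _ _).trans
    (Nat.add_le_add_left Finset.card_biUnion_le _))
  have hcard' := (Nat.cast_le (α := ℝ)).2 hcard
  push_cast at hcard'
  have hsum := Finset.sum_le_sum hscale
  rw [Finset.sum_const, Finset.card_range, nsmul_eq_mul] at hsum
  linarith

end IsDiscreteArc

/-! ### Covering numbers and box dimension -/

lemma coverNum_le_card {n : ℕ} {r : ℝ} {F : Set (EuclideanSpace ℝ (Fin n))}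
    {T : Finset (EuclideanSpace ℝ (Fin n))} (h : F ⊆ ⋃ a ∈ T, cube a r) :
    coverNum r F ≤ T.card := by
  refine (iInf₂_le (T : Set (EuclideanSpace ℝ (Fin n))) (by simpa using h)).trans ?_
  simp

lemma exists_finset_card_eq_coverNum {n : ℕ} {r : ℝ} {F : Set (EuclideanSpace ℝ (Fin n))}
    (h : coverNum r F ≠ ⊤) :
    ∃ T : Finset (EuclideanSpace ℝ (Fin n)), F ⊆ ⋃ a ∈ T, cube a r ∧
      (T.card : ℕ∞) = coverNum r F := by
  have h1 : coverNum r F = ⨅ T : {T : Set (EuclideanSpace ℝ (Fin n)) // F ⊆ ⋃ a ∈ T, cube a r},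
      T.1.encard := by
    rw [coverNum, iInf_subtype']
  have hne : Nonempty {T : Set (EuclideanSpace ℝ (Fin n)) // F ⊆ ⋃ a ∈ T, cube a r} := by
    by_contra hemp
    rw [not_nonempty_iff] at hemp
    exact h (by rw [h1, iInf_of_empty])
  obtain ⟨T, hT⟩ := ciInf_mem
    fun T : {T : Set (EuclideanSpace ℝ (Fin n)) // F ⊆ ⋃ a ∈ T, cube a r} => T.1.encard
  rw [← h1] at hT
  have hfin : T.1.Finite := Set.encard_ne_top_iff.1 (by simpa [hT] using h)
  refine ⟨hfin.toFinset, by simpa using T.2, ?_⟩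
  rw [← hT]
  exact hfin.encard_eq_coe_toFinset_card.symm

lemma log_ofReal_rpow_neg {r : ℝ} (hr : 0 < r) (q : ℝ) :
    ENNReal.log (ENNReal.ofReal (r ^ (-q))) = ((q * -Real.log r : ℝ) : EReal) := by
  rw [ENNReal.log_ofReal_of_pos (Real.rpow_pos_of_pos hr _), Real.log_rpow hr]
  congr 1
  ring

lemma eventually_small {ε : ℝ} (hε : 0 < ε) : ∀ᶠ r : ℝ in 𝓝[>] 0, 0 < r ∧ r < ε :=
  Ioo_mem_nhdsGT hε

lemma neg_log_pos {r : ℝ} (h0 : 0 < r) (h1 : r < 1) :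
    (0 : EReal) < ((-Real.log r : ℝ) : EReal) := by
  rw [EReal.coe_pos]
  linarith [Real.log_neg h0 h1]

lemma le_lowerBoxDim {n : ℕ} {F : Set (EuclideanSpace ℝ (Fin n))} {d : ℝ}
    (h : ∀ q < d, ∀ᶠ r : ℝ in 𝓝[>] 0, ENNReal.ofReal (r ^ (-q)) ≤ (coverNum r F : ℝ≥0∞)) :
    (d : EReal) ≤ lowerBoxDim F := by
  refine le_of_forall_lt_imp_le_of_dense fun c hc => ?_
  obtain ⟨q, hcq, hqd⟩ := EReal.lt_iff_exists_real_btwn.1 hc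
  refine hcq.le.trans (le_liminf_of_le (by isBoundedDefault) ?_)
  filter_upwards [h q (by exact_mod_cast hqd), eventually_small one_pos] with r hr hr1
  rw [EReal.le_div_iff_mul_le (neg_log_pos hr1.1 hr1.2) (EReal.coe_ne_top _), ← EReal.coe_mul,
    ← log_ofReal_rpow_neg hr1.1]
  exact ENNReal.log_monotone hr

lemma lowerBoxDim_le {n : ℕ} {F : Set (EuclideanSpace ℝ (Fin n))} {d : ℝ}
    (h : ∀ q > d, ∃ᶠ r : ℝ in 𝓝[>] 0, (coverNum r F : ℝ≥0∞) ≤ ENNReal.ofReal (r ^ (-q))) :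
    lowerBoxDim F ≤ (d : EReal) := by
  refine le_of_forall_gt_imp_ge_of_dense fun c hc => ?_
  obtain ⟨q, hdq, hqc⟩ := EReal.lt_iff_exists_real_btwn.1 hc
  refine le_trans (liminf_le_of_frequently_le' ?_) hqc.le
  refine ((h q (by exact_mod_cast hdq)).and_eventually (eventually_small one_pos)).mono ?_
  rintro r ⟨hr, hr1⟩
  rw [EReal.div_le_iff_le_mul (neg_log_pos hr1.1 hr1.2) (EReal.coe_ne_top _), mul_comm,
    ← EReal.coe_mul, ← log_ofReal_rpow_neg hr1.1]
  exact ENNReal.log_monotone hr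

/-! ### Lower bounds in the plane -/

/-- The coordinates of a point of the Euclidean plane. -/
def planeCoords (x : EuclideanSpace ℝ (Fin 2)) : ℝ × ℝ := (x 0, x 1)

/-- Pairs of points of a dipole Kakeya set whose differences form a separated subset of an arc
turn every cover of the set by `δ`-cubes into a discretised arc. -/
lemma IsDipoleKakeya.exists_isDiscreteArc {A : Set (EuclideanSpace ℝ (Fin 2))}
    (hA : IsDipoleKakeya A) {δ : ℝ} (hδ : 0 < δ) (hδ' : δ ≤ 1 / 20)
    {T : Finset (EuclideanSpace ℝ (Fin 2))} (hT : A ⊆ ⋃ t ∈ T, cube t δ) :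
    ∃ (M : ℕ) (a b : ℕ → EuclideanSpace ℝ (Fin 2)),
      IsDiscreteArc δ (T.image planeCoords) M (planeCoords ∘ a) (planeCoords ∘ b) ∧
      (∀ j < M, (cube (a j) δ ∩ A).Nonempty) ∧ ∀ j < M, (cube (b j) δ ∩ A).Nonempty := by
  set M := ⌊1 / (6 * δ)⌋₊ with hM
  have hMle : (M : ℝ) ≤ 1 / (6 * δ) := Nat.floor_le (by positivity)
  have hMge : 1 / (6 * δ) < M + 1 := Nat.lt_floor_add_one _
  rw [le_div_iff₀ (by positivity)] at hMle
  rw [div_lt_iff₀ (by positivity)] at hMge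
  have hex : ∀ j : ℕ, ∃ p : EuclideanSpace ℝ (Fin 2) × EuclideanSpace ℝ (Fin 2), j < M →
      p.1 ∈ T ∧ p.2 ∈ T ∧ (cube p.1 δ ∩ A).Nonempty ∧ (cube p.2 δ ∩ A).Nonempty ∧
      |p.2 0 - p.1 0 - 3 * δ * j| ≤ δ ∧ |p.2 1 - p.1 1 - semicircle (3 * δ * j)| ≤ δ := by
    intro j
    by_cases hj : j < M
    swap
    · exact ⟨0, fun h => absurd h hj⟩
    have hjM : (j : ℝ) ≤ M := by exact_mod_cast hj.le
    have hu0 : 0 ≤ 3 * δ * j := by positivity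
    have hu1 : 3 * δ * j ≤ 1 / 2 := by nlinarith
    have hmem : !₂[3 * δ * (j : ℝ), semicircle (3 * δ * j)] ∈
        Metric.sphere (0 : EuclideanSpace ℝ (Fin 2)) 1 := by
      rw [mem_sphere_zero_iff_norm, EuclideanSpace.norm_eq, Real.sqrt_eq_one, Fin.sum_univ_two]
      simp only [Real.norm_eq_abs, sq_abs]
      change (3 * δ * (j : ℝ)) ^ 2 + semicircle (3 * δ * j) ^ 2 = 1
      rw [semicircle, Real.sq_sqrt (by nlinarith)]
      ring
    obtain ⟨y, hy, x, hx, hxy⟩ := hA.2 hmem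
    have h0 : y 0 - x 0 = 3 * δ * (j : ℝ) := congrArg (fun v => v 0) hxy
    have h1 : y 1 - x 1 = semicircle (3 * δ * j) := congrArg (fun v => v 1) hxy
    obtain ⟨t, ht, hxt⟩ := Set.mem_iUnion₂.1 (hT hx)
    obtain ⟨t', ht', hyt⟩ := Set.mem_iUnion₂.1 (hT hy)
    refine ⟨(t, t'), fun _ => ⟨ht, ht', ⟨x, hxt, hx⟩, ⟨y, hyt, hy⟩, ?_, ?_⟩⟩
    · have := hxt 0
      have := hyt 0
      rw [abs_le]; constructor <;> linarith
    · have := hxt 1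
      have := hyt 1
      rw [abs_le]; constructor <;> linarith
  choose p hp using hex
  refine ⟨M, fun j => (p j).1, fun j => (p j).2, ⟨hδ, hδ', by linarith, by linarith,
    fun j hj => Finset.mem_image_of_mem _ (hp j hj).1,
    fun j hj => Finset.mem_image_of_mem _ (hp j hj).2.1,
    fun j hj => (hp j hj).2.2.2.2.1, fun j hj => (hp j hj).2.2.2.2.2⟩,
    fun j hj => (hp j hj).2.2.1, fun j hj => (hp j hj).2.2.2.1⟩

theorem four_sevenths_le_lowerBoxDim {A : Set (EuclideanSpace ℝ (Fin 2))}
    (hA : IsDipoleKakeya A) : ((4 / 7 : ℝ) : EReal) ≤ lowerBoxDim A := by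
  refine le_lowerBoxDim fun q hq => ?_
  have he : 0 < 2 - 7 / 2 * q := by linarith
  have htend : Tendsto (fun r : ℝ => 133056 * r ^ (2 - 7 / 2 * q)) (𝓝[>] 0) (𝓝 0) := by
    have h1 := (Real.continuousAt_rpow_const 0 (2 - 7 / 2 * q) (Or.inr he.le)).tendsto.const_mul
      133056
    rw [Real.zero_rpow he.ne', mul_zero] at h1
    exact h1.mono_left nhdsWithin_le_nhds
  filter_upwards [htend.eventually_lt_const one_pos,
    eventually_small (show (0 : ℝ) < 1 / 20 by norm_num)] with r hr hr1
  by_cases htop : coverNum r A = ⊤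
  · rw [htop]; simp
  obtain ⟨T, hT, hTcard⟩ := exists_finset_card_eq_coverNum htop
  obtain ⟨M, a, b, h, -, -⟩ := hA.exists_isDiscreteArc hr1.1 hr1.2.le hT
  rw [← hTcard]
  have hr0 := hr1.1
  have key := h.sq_le_card_rpow
  have hNle : ((T.image planeCoords).card : ℝ) ≤ T.card := by exact_mod_cast Finset.card_image_le
  suffices r ^ (-q) ≤ T.card by
    refine (ENNReal.ofReal_le_ofReal this).trans_eq ?_
    simp
  by_contra hlt
  push Not at hlt
  have h1 : (T.card : ℝ) ^ (7 / 2 : ℝ) ≤ r ^ (-(7 / 2 * q)) := by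
    rw [show -(7 / 2 * q) = -q * (7 / 2) by ring, Real.rpow_mul hr0.le]
    gcongr
  have h2 : ((T.image planeCoords).card : ℝ) ^ (7 / 2 : ℝ) ≤ (T.card : ℝ) ^ (7 / 2 : ℝ) := by
    gcongr
  have h3 : 1 ≤ (12 * r * M) ^ 2 := one_le_pow₀ h.long
  have h4 : r ^ (2 - 7 / 2 * q) = r ^ 2 * r ^ (-(7 / 2 * q)) := by
    rw [sub_eq_add_neg, Real.rpow_add hr0]
    norm_num
  rw [h4] at hr
  have h5 : (M : ℝ) ^ 2 ≤ 924 * r ^ (-(7 / 2 * q)) := by linarith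
  have h6 := mul_le_mul_of_nonneg_left h5 (show 0 ≤ 144 * r ^ 2 by positivity)
  linarith

lemma dist_le_add_abs (x y : EuclideanSpace ℝ (Fin 2)) :
    dist x y ≤ |x 0 - y 0| + |x 1 - y 1| := by
  rw [EuclideanSpace.dist_eq, Fin.sum_univ_two, Real.dist_eq, Real.dist_eq]
  refine Real.sqrt_le_iff.2 ⟨by positivity, ?_⟩
  nlinarith [abs_nonneg (x 0 - y 0), abs_nonneg (x 1 - y 1)]

/-- In a minimal cover the number of cubes near a point of the set is at most the covering
number of a ball: otherwise those cubes could be exchanged for a cover of that ball. -/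
lemma ballCount_le_of_minimal {A : Set (EuclideanSpace ℝ (Fin 2))} {δ : ℝ}
    {T : Finset (EuclideanSpace ℝ (Fin 2))} (hT : A ⊆ ⋃ t ∈ T, cube t δ)
    (hTcard : (T.card : ℕ∞) = coverNum δ A) {t x : EuclideanSpace ℝ (Fin 2)}
    (hx : x ∈ cube t δ) {R K : ℝ} (hR : δ ≤ R) (hK : 0 ≤ K)
    (hcov : (coverNum δ (Metric.closedBall x (4 * R) ∩ A) : ℝ≥0∞) ≤ ENNReal.ofReal K) :
    (ballCount (T.image planeCoords) (planeCoords t) R : ℝ) ≤ K := by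
  classical
  obtain ⟨T₂, hT₂, hT₂card⟩ := exists_finset_card_eq_coverNum (r := δ)
    (F := Metric.closedBall x (4 * R) ∩ A) (by
      intro htop
      rw [htop] at hcov
      simp at hcov)
  rw [← hT₂card] at hcov
  have hT₂K : (T₂.card : ℝ) ≤ K := by
    have : ENNReal.ofReal (T₂.card : ℝ) ≤ ENNReal.ofReal K := by simpa using hcov
    exact (ENNReal.ofReal_le_ofReal_iff hK).1 this
  set T₁ := T.filter fun t' => dist (planeCoords t') (planeCoords t) ≤ R with hT₁
  have h1 : ballCount (T.image planeCoords) (planeCoords t) R ≤ T₁.card := by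
    rw [ballCount, Finset.filter_image]
    exact Finset.card_image_le
  have hcover : A ⊆ ⋃ s ∈ (T \ T₁) ∪ T₂, cube s δ := by
    intro y hy
    obtain ⟨s, hs, hys⟩ := Set.mem_iUnion₂.1 (hT hy)
    by_cases hs1 : s ∈ T₁
    · have hd := dist_le_iff_coords.1 (Finset.mem_filter.1 hs1).2
      have d0 := abs_le.1 hd.1
      have d1 := abs_le.1 hd.2
      have hy' : y ∈ Metric.closedBall x (4 * R) := by
        refine (dist_le_add_abs y x).trans ?_
        simp only [planeCoords] at d0 d1
        have x0 := hx 0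
        have x1 := hx 1
        have y0 := hys 0
        have y1 := hys 1
        have e0 : |y 0 - x 0| ≤ 2 * R := abs_le.2 ⟨by linarith, by linarith⟩
        have e1 : |y 1 - x 1| ≤ 2 * R := abs_le.2 ⟨by linarith, by linarith⟩
        linarith
      obtain ⟨s', hs', hys'⟩ := Set.mem_iUnion₂.1 (hT₂ ⟨hy', hy⟩)
      exact Set.mem_iUnion₂.2 ⟨s', Finset.mem_union_right _ hs', hys'⟩
    · exact Set.mem_iUnion₂.2 ⟨s, Finset.mem_union_left _ (Finset.mem_sdiff.2 ⟨hs, hs1⟩), hys⟩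
  have h2 := coverNum_le_card hcover
  rw [← hTcard] at h2
  have h3 : T.card ≤ (T \ T₁).card + T₂.card :=
    le_trans (by exact_mod_cast h2) (Finset.card_union_le _ _)
  have hsub : T₁ ⊆ T := Finset.filter_subset _ _
  have h4 := Finset.card_sdiff_add_card_eq_card hsub
  have h5 : T₁.card ≤ T₂.card := by omega
  have h6 : (ballCount (T.image planeCoords) (planeCoords t) R : ℝ) ≤ T₂.card := by
    exact_mod_cast h1.trans h5
  exact h6.trans hT₂K

theorem two_thirds_le_assouadDim {A : Set (EuclideanSpace ℝ (Fin 2))}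
    (hA : IsDipoleKakeya A) : ((2 / 3 : ℝ) : EReal) ≤ assouadDim A := by
  refine le_iInf₂ fun s ⟨hs0, C, hC, hcov⟩ => ?_
  rw [EReal.coe_le_coe_iff]
  by_contra hs
  push Not at hs
  obtain ⟨x₀, hx₀⟩ : A.Nonempty := by
    obtain ⟨y, hy, -⟩ := hA.2 (show EuclideanSpace.single (0 : Fin 2) (1 : ℝ) ∈ _ by simp)
    exact ⟨y, hy⟩
  obtain ⟨R₀, hR₀, hAR₀⟩ : ∃ R₀ : ℝ, 1 < R₀ ∧ A ⊆ Metric.closedBall x₀ R₀ := by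
    obtain ⟨R, hR⟩ := hA.1.subset_closedBall x₀
    exact ⟨max R 2, lt_of_lt_of_le one_lt_two (le_max_right _ _),
      hR.trans (Metric.closedBall_subset_closedBall (le_max_left _ _))⟩
  set C₁ := C * R₀ ^ s with hC₁
  set C₂ := C * 4 ^ s with hC₂
  have hC₁0 : 0 < C₁ := by positivity
  have hC₂0 : 0 < C₂ := by positivity
  -- the incidence bound at scale `2⁻ᵐ`
  have key : ∀ m : ℕ, 5 ≤ m → (1 : ℝ) / 144 ≤
      4 * C₁ * (2 ^ (s - 1)) ^ m + C₁ ^ 2 * C₂ ^ 2 * 60 ^ s * (m * (2 ^ (3 * s - 2)) ^ m) := by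
    intro m hm
    set δ : ℝ := (2 : ℝ)⁻¹ ^ m with hδdef
    have hδ : 0 < δ := by positivity
    have hδ2 : δ * 2 ^ m = 1 := by rw [hδdef, ← mul_pow]; norm_num
    have hδ' : δ ≤ 1 / 20 := by
      calc δ ≤ (2 : ℝ)⁻¹ ^ 5 := pow_le_pow_of_le_one (by norm_num) (by norm_num) hm
        _ ≤ 1 / 20 := by norm_num
    have hdiv : ∀ R : ℝ, R / δ = R * 2 ^ m := fun R => by
      rw [div_eq_iff hδ.ne', mul_assoc, mul_comm _ δ, hδ2, mul_one]
    have hcov₀ := hcov R₀ (by linarith) δ hδ (by linarith) x₀ hx₀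
    rw [Set.inter_eq_right.2 hAR₀] at hcov₀
    obtain ⟨T, hT, hTcard⟩ := exists_finset_card_eq_coverNum (r := δ) (F := A) (by
      intro htop
      rw [htop] at hcov₀
      simp at hcov₀)
    have hball : ∀ t, (cube t δ ∩ A).Nonempty → ∀ R, δ ≤ R →
        (ballCount (T.image planeCoords) (planeCoords t) R : ℝ) ≤ C₂ * (R / δ) ^ s := by
      rintro t ⟨x, hxt, hxA⟩ R hR
      have hR0 : 0 < R := hδ.trans_le hR
      refine ballCount_le_of_minimal hT hTcard hxt hR (by positivity) ?_
      have := hcov (4 * R) (by positivity) δ hδ (by linarith) x hxA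
      rwa [mul_div_assoc, Real.mul_rpow (by norm_num) (by positivity), ← mul_assoc] at this
    obtain ⟨M, a, b, h, ha, hb⟩ := hA.exists_isDiscreteArc hδ hδ' hT
    have main := h.sq_le_of_ballCount_le hC₂0.le (fun j hj => hball _ (ha j hj))
      fun j hj => hball _ (hb j hj)
    have hN : ((T.image planeCoords).card : ℝ) ≤ C₁ * (2 ^ m) ^ s := by
      have h1 : (T.card : ℝ) ≤ C * (R₀ / δ) ^ s := by
        rw [← hTcard] at hcov₀
        have : ENNReal.ofReal (T.card : ℝ) ≤ ENNReal.ofReal (C * (R₀ / δ) ^ s) := by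
          simpa using hcov₀
        exact (ENNReal.ofReal_le_ofReal_iff (by positivity)).1 this
      rw [hdiv, Real.mul_rpow (by linarith) (by positivity), ← mul_assoc] at h1
      exact le_trans (by exact_mod_cast Finset.card_image_le) h1
    set N : ℝ := ((T.image planeCoords).card : ℝ)
    have hN0 : 0 ≤ N := Nat.cast_nonneg _
    set X : ℝ := 2 ^ m with hX
    have hX0 : 0 < X := by positivity
    have hM : (M : ℝ) ≤ X := by
      have h1 := h.short
      have h2 : δ * M ≤ δ * X := by rw [hδ2]; linarith
      exact le_of_mul_le_mul_left h2 hδ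
    have hM' : X ≤ 12 * M := by
      have h1 := h.long
      have h2 : δ * X ≤ δ * (12 * M) := by rw [hδ2]; linarith
      exact le_of_mul_le_mul_left h2 hδ
    have h1 : X ^ 2 / 144 ≤ C₁ * X ^ s * (4 * X + m * (C₁ * X ^ s * (C₂ ^ 2 * (60 * X) ^ s))) := by
      calc X ^ 2 / 144 ≤ (M : ℝ) ^ 2 := by nlinarith
        _ ≤ _ := main
        _ ≤ _ := by gcongr
    rw [Real.mul_rpow (by norm_num) hX0.le] at h1
    have e1 : ((2 : ℝ) ^ (s - 1)) ^ m * X ^ 2 = X ^ s * X := by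
      rw [← Real.rpow_natCast, ← Real.rpow_mul (by norm_num), mul_comm, mul_comm (s - 1),
        Real.rpow_mul (by norm_num), Real.rpow_natCast, ← hX, Real.rpow_sub_one hX0.ne']
      field_simp
    have e2 : ((2 : ℝ) ^ (3 * s - 2)) ^ m * X ^ 2 = X ^ s * X ^ s * X ^ s := by
      rw [← Real.rpow_natCast, ← Real.rpow_mul (by norm_num), mul_comm (3 * s - 2),
        Real.rpow_mul (by norm_num), Real.rpow_natCast, ← hX, ← Real.rpow_add hX0,
        ← Real.rpow_add hX0, ← Real.rpow_natCast, ← Real.rpow_add hX0]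
      congr 1
      push_cast
      ring
    have h2 : X ^ 2 * (1 / 144) ≤ X ^ 2 * (4 * C₁ * (2 ^ (s - 1)) ^ m
        + C₁ ^ 2 * C₂ ^ 2 * 60 ^ s * (m * (2 ^ (3 * s - 2)) ^ m)) := by
      calc X ^ 2 * (1 / 144) = X ^ 2 / 144 := by ring
        _ ≤ _ := h1
        _ = 4 * C₁ * (X ^ s * X) + C₁ ^ 2 * C₂ ^ 2 * 60 ^ s * (m * (X ^ s * X ^ s * X ^ s)) := by
            ring
        _ = _ := by rw [← e1, ← e2]; ring
    exact le_of_mul_le_mul_left h2 (by positivity)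
  -- letting `m → ∞` contradicts `s < 2 / 3`
  have t1 : Tendsto (fun m : ℕ => ((2 : ℝ) ^ (s - 1)) ^ m) atTop (𝓝 0) :=
    tendsto_pow_atTop_nhds_zero_of_lt_one (by positivity)
      (Real.rpow_lt_one_of_one_lt_of_neg one_lt_two (by linarith))
  have t2 : Tendsto (fun m : ℕ => (m : ℝ) * ((2 : ℝ) ^ (3 * s - 2)) ^ m) atTop (𝓝 0) :=
    tendsto_self_mul_const_pow_of_lt_one (by positivity)
      (Real.rpow_lt_one_of_one_lt_of_neg one_lt_two (by linarith))
  have t3 := (t1.const_mul (4 * C₁)).add (t2.const_mul (C₁ ^ 2 * C₂ ^ 2 * 60 ^ s))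
  have t4 := ge_of_tendsto t3 ((eventually_ge_atTop 5).mono key)
  norm_num at t4

/-! ### Nets in balls and spheres -/

/-- A finite-valued labelling whose classes have diameter at most `ε` yields an `ε`-net. -/
lemma exists_net_of_key {α β : Type*} [PseudoMetricSpace α] {S : Set α} {κ : α → β}
    {K : Finset β} (hκ : ∀ x ∈ S, κ x ∈ K) {ε : ℝ}
    (h : ∀ x ∈ S, ∀ y ∈ S, κ x = κ y → dist x y ≤ ε) :
    ∃ F : Finset α, F.card ≤ K.card ∧ (∀ f ∈ F, f ∈ S) ∧ ∀ x ∈ S, ∃ f ∈ F, dist x f ≤ ε := by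
  obtain ⟨s, hsS, hbij⟩ := Set.exists_subset_bijOn S κ
  have hmaps : Set.MapsTo κ s K := fun x hx => hκ x (hsS hx)
  have hfin : s.Finite := Set.Finite.of_injOn hmaps hbij.injOn K.finite_toSet
  refine ⟨hfin.toFinset, Finset.card_le_card_of_injOn κ (by simpa using hmaps)
    (by simpa using hbij.injOn), fun f hf => hsS (hfin.mem_toFinset.1 hf), fun x hx => ?_⟩
  obtain ⟨f, hf, hfx⟩ := hbij.surjOn (Set.mem_image_of_mem κ hx)
  exact ⟨f, hfin.mem_toFinset.2 hf, h x hx f (hsS hf) hfx.symm⟩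

lemma dist_le_sum_abs {n : ℕ} (x y : EuclideanSpace ℝ (Fin n)) :
    dist x y ≤ ∑ i, |x i - y i| := by
  rw [EuclideanSpace.dist_eq]
  refine Real.sqrt_le_iff.2 ⟨Finset.sum_nonneg fun i _ => abs_nonneg _, ?_⟩
  simp only [Real.dist_eq]
  exact Finset.sum_sq_le_sq_sum_of_nonneg fun i _ => abs_nonneg _

lemma abs_apply_sub_le {n : ℕ} (x y : EuclideanSpace ℝ (Fin n)) (i : Fin n) :
    |x i - y i| ≤ dist x y := by
  rw [dist_eq_norm]
  exact PiLp.norm_apply_le (x - y) i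

lemma abs_sub_le_of_floor_eq {x y h : ℝ} (hh : 0 < h) (hxy : ⌊x / h⌋ = ⌊y / h⌋) :
    |x - y| ≤ h := by
  have h1 := (Int.abs_sub_lt_one_of_floor_eq_floor hxy).le
  rw [← sub_div, abs_div, abs_of_pos hh, div_le_one hh] at h1
  exact h1

lemma floor_div_mem_Icc {x h β : ℝ} (hh : 0 < h) (hx : |x| ≤ β) :
    ⌊x / h⌋ ∈ Finset.Icc (-(⌈β / h⌉₊ : ℤ)) ⌈β / h⌉₊ := by
  have h1 := abs_le.1 hx
  have h2 : β / h ≤ ⌈β / h⌉₊ := Nat.le_ceil _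
  rw [Finset.mem_Icc]
  constructor
  · rw [Int.le_floor]
    push_cast
    have : -(β / h) ≤ x / h := by rw [← neg_div]; gcongr; exact h1.1
    linarith
  · have h3 : (⌊x / h⌋ : ℝ) ≤ x / h := Int.floor_le _
    have : x / h ≤ β / h := by gcongr; exact h1.2
    exact_mod_cast (h3.trans this).trans h2

lemma card_Icc_ceil_le {h β : ℝ} (hh : 0 < h) (hβ : h ≤ β) :
    ((Finset.Icc (-(⌈β / h⌉₊ : ℤ)) ⌈β / h⌉₊).card : ℝ) ≤ 5 * (β / h) := by
  have hβ0 : 0 < β := hh.trans_le hβ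
  have h1 : (⌈β / h⌉₊ : ℝ) < β / h + 1 := Nat.ceil_lt_add_one (by positivity)
  have h2 : 1 ≤ β / h := (one_le_div hh).2 hβ
  have h3 : (Finset.Icc (-(⌈β / h⌉₊ : ℤ)) ⌈β / h⌉₊).card = 2 * ⌈β / h⌉₊ + 1 := by
    rw [Int.card_Icc]
    omega
  rw [h3]
  push_cast
  linarith

lemma exists_net_closedBall {n : ℕ} (hn : 0 < n) {ε β : ℝ} (hε : 0 < ε) (hεβ : ε ≤ β) :
    ∃ F : Finset (EuclideanSpace ℝ (Fin n)), (F.card : ℝ) ≤ (5 * n * (β / ε)) ^ n ∧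
      (∀ f ∈ F, ‖f‖ ≤ β) ∧ ∀ x, ‖x‖ ≤ β → ∃ f ∈ F, dist x f ≤ ε := by
  have hn1 : (1 : ℝ) ≤ n := by exact_mod_cast hn
  set h := ε / n with hh
  have h0 : 0 < h := by positivity
  have hhβ : h ≤ β := (div_le_self hε.le hn1).trans hεβ
  obtain ⟨F, hF, hFS, hnet⟩ := exists_net_of_key (S := {x : EuclideanSpace ℝ (Fin n) | ‖x‖ ≤ β})
    (κ := fun x i => ⌊x i / h⌋)
    (K := Fintype.piFinset fun _ => Finset.Icc (-(⌈β / h⌉₊ : ℤ)) ⌈β / h⌉₊) (ε := ε)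
    (fun x hx => Fintype.mem_piFinset.2 fun i =>
      floor_div_mem_Icc h0 ((PiLp.norm_apply_le x i).trans hx))
    (fun x _ y _ hxy => by
      refine (dist_le_sum_abs x y).trans ((Finset.sum_le_card_nsmul _ _ h fun i _ =>
        abs_sub_le_of_floor_eq h0 (congrFun hxy i)).trans_eq ?_)
      rw [Finset.card_univ, Fintype.card_fin, nsmul_eq_mul, hh]
      field_simp)
  refine ⟨F, ?_, hFS, hnet⟩
  rw [Fintype.card_piFinset_const] at hF
  calc (F.card : ℝ) ≤ ((Finset.Icc (-(⌈β / h⌉₊ : ℤ)) ⌈β / h⌉₊).card : ℝ) ^ n := by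
        exact_mod_cast hF
    _ ≤ (5 * (β / h)) ^ n := by gcongr; exact card_Icc_ceil_le h0 hhβ
    _ = (5 * n * (β / ε)) ^ n := by rw [hh]; congr 1; field_simp

/-- On the part of the sphere where the `i`-th coordinate is not small, that coordinate is
determined by its sign and, in a Lipschitz way, by the others; so a net needs only `m`
coordinates in dimension `m + 1`. -/
lemma exists_net_sphere_part {m : ℕ} (i : Fin (m + 1)) {β : ℝ} (hβ : 0 < β) (hβ1 : β ≤ 1) :
    ∃ F : Finset (EuclideanSpace ℝ (Fin (m + 1))),
      (F.card : ℝ) ≤ 2 * (5 * (m + 1) ^ 2 / β) ^ m ∧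
      (∀ f ∈ F, ‖f‖ = 1) ∧ ∀ x : EuclideanSpace ℝ (Fin (m + 1)), ‖x‖ = 1 → 1 ≤ (m + 1) * x i ^ 2 →
        ∃ f ∈ F, dist x f ≤ β := by
  set h : ℝ := β / (m + 1) ^ 2 with hh
  have h0 : 0 < h := by positivity
  have hh1 : h ≤ 1 :=
    (div_le_self hβ.le (one_le_pow₀ (by linarith [Nat.cast_nonneg (α := ℝ) m]))).trans hβ1
  have hsq : ∀ x : EuclideanSpace ℝ (Fin (m + 1)), ‖x‖ = 1 →
      x i ^ 2 = 1 - ∑ j, x (i.succAbove j) ^ 2 := by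
    intro x hx
    have h1 := EuclideanSpace.real_norm_sq_eq x
    rw [hx, Fin.sum_univ_succAbove _ i] at h1
    linarith
  have habs : ∀ x : EuclideanSpace ℝ (Fin (m + 1)), ‖x‖ = 1 → ∀ j, |x j| ≤ 1 := fun x hx j =>
    (PiLp.norm_apply_le x j).trans hx.le
  obtain ⟨F, hF, hFS, hnet⟩ := exists_net_of_key
    (S := {x : EuclideanSpace ℝ (Fin (m + 1)) | ‖x‖ = 1 ∧ 1 ≤ (m + 1) * x i ^ 2})
    (κ := fun x => (decide (0 ≤ x i), fun j : Fin m => ⌊x (i.succAbove j) / h⌋))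
    (K := (Finset.univ : Finset Bool) ×ˢ
      Fintype.piFinset fun _ : Fin m => Finset.Icc (-(⌈1 / h⌉₊ : ℤ)) ⌈1 / h⌉₊) (ε := β)
    (fun x hx => Finset.mem_product.2 ⟨Finset.mem_univ _, Fintype.mem_piFinset.2 fun j =>
      floor_div_mem_Icc h0 (habs x hx.1 _)⟩)
    (fun x hx y hy hxy => by
      obtain ⟨hx1, hxi⟩ := hx
      obtain ⟨hy1, hyi⟩ := hy
      simp only [Prod.mk.injEq, decide_eq_decide] at hxy
      obtain ⟨hsign, hfl⟩ := hxy
      have hj : ∀ j, |x (i.succAbove j) - y (i.succAbove j)| ≤ h := fun j =>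
        abs_sub_le_of_floor_eq h0 (congrFun hfl j)
      have hsum : ∑ j, |x (i.succAbove j) - y (i.succAbove j)| ≤ m * h := by
        refine (Finset.sum_le_card_nsmul _ _ h fun j _ => hj j).trans_eq ?_
        rw [Finset.card_univ, Fintype.card_fin, nsmul_eq_mul]
      have hdiff : |x i ^ 2 - y i ^ 2| ≤ 2 * (m * h) := by
        rw [hsq x hx1, hsq y hy1, sub_sub_sub_cancel_left, ← Finset.sum_sub_distrib]
        refine (Finset.abs_sum_le_sum_abs _ _).trans ?_
        have : 2 * (m * h) = ∑ _j : Fin m, 2 * h := by simp; ring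
        rw [this]
        refine Finset.sum_le_sum fun j _ => ?_
        rw [sq_sub_sq, abs_mul]
        have h1 := (abs_add_le (y (i.succAbove j)) (x (i.succAbove j))).trans
          (add_le_add (habs y hy1 _) (habs x hx1 _))
        have h2 := hj j
        rw [abs_sub_comm] at h2
        have := mul_le_mul h1 h2 (abs_nonneg _) (by norm_num)
        linarith
      have hlow : ∀ z : EuclideanSpace ℝ (Fin (m + 1)), ‖z‖ = 1 → 1 ≤ (m + 1) * z i ^ 2 →
          1 ≤ (m + 1) * |z i| := by
        intro z hz hzi
        refine hzi.trans ?_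
        rw [← sq_abs, sq]
        exact mul_le_mul_of_nonneg_left
          (mul_le_of_le_one_left (abs_nonneg _) (habs z hz i)) (by positivity)
      have hadd : |x i + y i| = |x i| + |y i| := by
        rcases le_or_gt 0 (x i) with h1 | h1
        · have h2 := hsign.1 h1
          rw [abs_of_nonneg h1, abs_of_nonneg h2, abs_of_nonneg (by linarith)]
        · have h2 : y i < 0 := by
            by_contra hc
            exact absurd (hsign.2 (not_lt.1 hc)) (not_le.2 h1)
          rw [abs_of_neg h1, abs_of_neg h2, abs_of_neg (by linarith)]
          ring
      have hxi' := hlow x hx1 hxi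
      have hyi' := hlow y hy1 hyi
      have hi : |x i - y i| ≤ (m + 1) * (m * h) := by
        rw [sq_sub_sq, abs_mul, hadd] at hdiff
        have h1 : 2 * |x i - y i| ≤ (m + 1) * (|x i| + |y i|) * |x i - y i| :=
          mul_le_mul_of_nonneg_right (by linarith) (abs_nonneg _)
        have h2 := mul_le_mul_of_nonneg_left hdiff (show (0 : ℝ) ≤ m + 1 by positivity)
        linarith
      refine (dist_le_sum_abs x y).trans ?_
      rw [Fin.sum_univ_succAbove _ i]
      have e : β = (m + 1) ^ 2 * h := by rw [hh]; field_simp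
      rw [e]
      nlinarith)
  refine ⟨F, ?_, fun f hf => (hFS f hf).1, fun x h1 h2 => hnet x ⟨h1, h2⟩⟩
  rw [Finset.card_product, Finset.card_univ, Fintype.card_bool, Fintype.card_piFinset_const] at hF
  calc (F.card : ℝ) ≤ 2 * ((Finset.Icc (-(⌈1 / h⌉₊ : ℤ)) ⌈1 / h⌉₊).card : ℝ) ^ m := by
        exact_mod_cast hF
    _ ≤ 2 * (5 * (1 / h)) ^ m := by gcongr; exact card_Icc_ceil_le h0 hh1
    _ = 2 * (5 * (m + 1) ^ 2 / β) ^ m := by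
      rw [hh]; congr 2; field_simp

lemma exists_net_sphere {m : ℕ} {β : ℝ} (hβ : 0 < β) (hβ1 : β ≤ 1) :
    ∃ F : Finset (EuclideanSpace ℝ (Fin (m + 1))),
      (F.card : ℝ) ≤ (m + 1) * (2 * (5 * (m + 1) ^ 2 / β) ^ m) ∧
      (∀ f ∈ F, ‖f‖ = 1) ∧
      ∀ x : EuclideanSpace ℝ (Fin (m + 1)), ‖x‖ = 1 → ∃ f ∈ F, dist x f ≤ β := by
  classical
  choose F hF hFS hnet using fun i : Fin (m + 1) => exists_net_sphere_part i hβ hβ1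
  refine ⟨Finset.univ.biUnion F, ?_, fun f hf => ?_, fun x hx => ?_⟩
  · calc ((Finset.univ.biUnion F).card : ℝ) ≤ ∑ i, ((F i).card : ℝ) := by
          exact_mod_cast Finset.card_biUnion_le
      _ ≤ ∑ _i : Fin (m + 1), 2 * (5 * ((m : ℝ) + 1) ^ 2 / β) ^ m :=
          Finset.sum_le_sum fun i _ => hF i
      _ = _ := by simp
  · obtain ⟨i, -, hi⟩ := Finset.mem_biUnion.1 hf
    exact hFS i f hi
  · obtain ⟨i, hi⟩ : ∃ i, 1 ≤ ((m : ℝ) + 1) * x i ^ 2 := by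
      by_contra! hc
      have h1 := EuclideanSpace.real_norm_sq_eq x
      rw [hx] at h1
      have h2 : ∑ i, ((m : ℝ) + 1) * x i ^ 2 < ∑ _i : Fin (m + 1), (1 : ℝ) :=
        Finset.sum_lt_sum_of_nonempty Finset.univ_nonempty fun i _ => hc i
      rw [← Finset.mul_sum, ← h1] at h2
      simp at h2
    obtain ⟨f, hf, hxf⟩ := hnet i x hx hi
    exact ⟨f, Finset.mem_biUnion.2 ⟨i, Finset.mem_univ _, hf⟩, hxf⟩

/-! ### A dipole Kakeya set that is small at infinitely many scales -/

/-- The differences of `P` form a `δ`-net for the unit sphere. -/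
def DifferencesCover {n : ℕ} (P : Finset (EuclideanSpace ℝ (Fin n))) (δ : ℝ) : Prop :=
  ∀ e : EuclideanSpace ℝ (Fin n), ‖e‖ = 1 → ∃ x ∈ P, ∃ z ∈ P, dist e (z - x) ≤ δ

/-- One refinement step. Each point `e` of a `β`-net of the sphere, which is `δ`-close to some
`z - x`, is realised exactly by moving `x` to `z - e`; the remaining error lies in
a ball of radius `β`, a `δ'`-net of which is added to `P`. The
choice `β = δ' ^ (n / (2n - 1))` balances the sizes of the two nets. -/
lemma DifferencesCover.exists_refinement {m : ℕ}
    {P : Finset (EuclideanSpace ℝ (Fin (m + 1)))} {δ : ℝ} (hδ : 0 < δ)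
    (hP : DifferencesCover P δ) {q : ℝ} (hq : ((m : ℝ) + 1) * m / (2 * m + 1) < q)
    {ε : ℝ} (hε : 0 < ε) :
    ∃ (P' : Finset (EuclideanSpace ℝ (Fin (m + 1)))) (δ' : ℝ), 0 < δ' ∧ δ' ≤ ε ∧ 2 * δ' ≤ δ ∧
      DifferencesCover P' δ' ∧ (∀ p ∈ P', ∃ p₀ ∈ P, dist p p₀ ≤ δ) ∧
      (P'.card : ℝ) ≤ (4 * δ') ^ (-q) := by
  classical
  set n : ℝ := (m : ℝ) + 1 with hn
  set d : ℝ := n * m / (2 * m + 1) with hd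
  set γ : ℝ := n / (2 * m + 1) with hγ
  have hm0 : (0 : ℝ) ≤ m := Nat.cast_nonneg m
  have hn0 : 0 < n := by positivity
  have hγ0 : 0 < γ := by positivity
  have hγ1 : γ ≤ 1 := by rw [hγ, div_le_one (by positivity)]; linarith
  have hγm : γ * m = d := by rw [hγ, hd]; ring
  have hγn : (1 - γ) * n = d := by rw [hγ, hd, hn]; field_simp; ring
  set C : ℝ := (n * (2 * (5 * n ^ 2) ^ m) + P.card * (5 * n) ^ (m + 1)) * 4 ^ q with hC
  -- all smallness conditions on the new scale `s`
  have hsmall : ∃ s : ℝ, 0 < s ∧ s < min ε (min (δ / 2) 1) ∧ s ^ γ < min δ 1 ∧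
      C * s ^ (q - d) < 1 := by
    have lim : ∀ e : ℝ, 0 < e → Tendsto (fun s : ℝ => s ^ e) (𝓝[>] 0) (𝓝 0) := by
      intro e he
      have h1 := (Real.continuousAt_rpow_const 0 e (Or.inr he.le)).tendsto
      rw [Real.zero_rpow he.ne'] at h1
      exact h1.mono_left nhdsWithin_le_nhds
    have l1 := (lim γ hγ0).eventually_lt_const (lt_min hδ one_pos)
    have l2 := ((lim (q - d) (by linarith)).const_mul C).eventually_lt_const
      (show C * 0 < 1 by simp)
    obtain ⟨s, h1, h2, h3⟩ := ((eventually_small (lt_min hε (lt_min (half_pos hδ) one_pos))).and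
      (l1.and l2)).exists
    exact ⟨s, h1.1, h1.2, h2, h3⟩
  obtain ⟨s, hs0, hs, hsγ, hsC⟩ := hsmall
  simp only [lt_min_iff] at hs hsγ
  set β := s ^ γ with hβ
  have hβ0 : 0 < β := Real.rpow_pos_of_pos hs0 _
  have hsβ : s ≤ β := by
    have := Real.rpow_le_rpow_of_exponent_ge hs0 hs.2.2.le hγ1
    rwa [Real.rpow_one] at this
  obtain ⟨F, hFcard, hFS, hF⟩ := exists_net_sphere (m := m) hβ0 hsγ.2.le
  obtain ⟨G, hGcard, hGS, hG⟩ := exists_net_closedBall (n := m + 1) m.succ_pos hs0 hsβ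
  -- the net points on the sphere, paired with nearby differences
  have hFx : ∀ e : EuclideanSpace ℝ (Fin (m + 1)),
      ∃ p : EuclideanSpace ℝ (Fin (m + 1)) × EuclideanSpace ℝ (Fin (m + 1)), ‖e‖ = 1 →
        p.1 ∈ P ∧ p.2 ∈ P ∧ dist e (p.2 - p.1) ≤ δ := by
    intro e
    by_cases he : ‖e‖ = 1
    · obtain ⟨x, hx, z, hz, hxz⟩ := hP e he
      exact ⟨(x, z), fun _ => ⟨hx, hz, hxz⟩⟩
    · exact ⟨0, fun h => absurd h he⟩
  choose p hp using hFx
  refine ⟨F.image (fun e => (p e).2 - e) ∪ Finset.image₂ (· + ·) P G, s, hs0, hs.1.le,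
    by linarith [hs.2.1], ?_, ?_, ?_⟩
  · intro e he
    obtain ⟨f, hf, hef⟩ := hF e he
    obtain ⟨g, hg, hfg⟩ := hG (e - f) (by rwa [← dist_eq_norm])
    refine ⟨(p f).2 - f, Finset.mem_union_left _ (Finset.mem_image_of_mem _ hf), (p f).2 + g,
      Finset.mem_union_right _ (Finset.mem_image₂_of_mem (hp f (hFS f hf)).2.1 hg), ?_⟩
    rw [dist_eq_norm] at hfg ⊢
    rwa [show e - ((p f).2 + g - ((p f).2 - f)) = e - f - g by abel]
  · intro y hy
    rcases Finset.mem_union.1 hy with hy | hy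
    · obtain ⟨f, hf, rfl⟩ := Finset.mem_image.1 hy
      obtain ⟨h1, -, h3⟩ := hp f (hFS f hf)
      refine ⟨(p f).1, h1, ?_⟩
      rw [dist_comm, dist_eq_norm] at h3
      rwa [dist_eq_norm, show (p f).2 - f - (p f).1 = (p f).2 - (p f).1 - f by abel]
    · obtain ⟨z, hz, g, hg, rfl⟩ := Finset.mem_image₂.1 hy
      refine ⟨z, hz, ?_⟩
      rw [dist_eq_norm, add_sub_cancel_left]
      exact (hGS g hg).trans hsγ.1.le
  · have hβm : (β ^ m)⁻¹ = s ^ (-d) := by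
      rw [hβ, ← Real.rpow_natCast, ← Real.rpow_mul hs0.le, ← Real.rpow_neg hs0.le, hγm]
    have hβs : (β / s) ^ (m + 1) = s ^ (-d) := by
      have h1 : β / s = s ^ (γ - 1) := by rw [Real.rpow_sub_one hs0.ne']
      rw [h1, ← Real.rpow_natCast, ← Real.rpow_mul hs0.le]
      congr 1
      push_cast
      rw [← hγn]
      ring
    have hcard : ((F.image (fun e => (p e).2 - e) ∪ Finset.image₂ (· + ·) P G).card : ℝ)
        ≤ F.card + P.card * G.card := by
      exact_mod_cast (Finset.card_union_le _ _).trans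
        (add_le_add Finset.card_image_le (Finset.card_image₂_le _ _ _))
    have h4 : (0 : ℝ) < 4 ^ q := Real.rpow_pos_of_pos (by norm_num) _
    have hsd : 0 < s ^ (-q) := Real.rpow_pos_of_pos hs0 _
    push_cast at hGcard
    rw [← hn] at hFcard hGcard
    rw [mul_pow, hβs] at hGcard
    rw [div_pow, div_eq_mul_inv, hβm] at hFcard
    have e1 : s ^ (-d) = s ^ (q - d) * s ^ (-q) := by
      rw [← Real.rpow_add hs0]; congr 1; ring
    have e2 : (4 * s) ^ (-q) = (4 ^ q)⁻¹ * s ^ (-q) := by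
      rw [Real.mul_rpow (by norm_num) hs0.le, Real.rpow_neg (by norm_num)]
    calc _ ≤ (F.card : ℝ) + P.card * G.card := hcard
      _ ≤ n * (2 * ((5 * n ^ 2) ^ m * s ^ (-d))) + P.card * ((5 * n) ^ (m + 1) * s ^ (-d)) := by
          gcongr
      _ = C * s ^ (q - d) * ((4 ^ q)⁻¹ * s ^ (-q)) := by
          rw [hC, e1]; field_simp
      _ ≤ 1 * ((4 ^ q)⁻¹ * s ^ (-q)) := by gcongr
      _ = (4 * s) ^ (-q) := by rw [e2, one_mul]

lemma closedBall_subset_cube {n : ℕ} (p : EuclideanSpace ℝ (Fin n)) (δ : ℝ) :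
    Metric.closedBall p (2 * δ) ⊆ cube (WithLp.toLp 2 fun i => p i - 2 * δ) (4 * δ) := by
  intro y hy i
  have h1 := abs_le.1 ((abs_apply_sub_le y p i).trans hy)
  change p i - 2 * δ ≤ y i ∧ y i ≤ p i - 2 * δ + 4 * δ
  constructor <;> linarith

/-- The closed `2δ`-neighbourhood of the finite set `P`. -/
def thickening {n : ℕ} (P : Finset (EuclideanSpace ℝ (Fin n))) (δ : ℝ) :
    Set (EuclideanSpace ℝ (Fin n)) :=
  ⋃ p ∈ P, Metric.closedBall p (2 * δ)

lemma mem_thickening {n : ℕ} {P : Finset (EuclideanSpace ℝ (Fin n))} {δ : ℝ}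
    {y : EuclideanSpace ℝ (Fin n)} : y ∈ thickening P δ ↔ ∃ p ∈ P, dist y p ≤ 2 * δ := by
  simp [thickening]

lemma isCompact_thickening {n : ℕ} (P : Finset (EuclideanSpace ℝ (Fin n))) (δ : ℝ) :
    IsCompact (thickening P δ) :=
  P.isCompact_biUnion fun p _ => isCompact_closedBall p _

lemma coverNum_thickening_le {n : ℕ} (P : Finset (EuclideanSpace ℝ (Fin n))) (δ : ℝ) :
    coverNum (4 * δ) (thickening P δ) ≤ P.card := by
  classical
  refine (coverNum_le_card (T := P.image fun p => WithLp.toLp 2 fun i => p i - 2 * δ) ?_).trans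
    (by exact_mod_cast Finset.card_image_le)
  refine Set.iUnion₂_subset fun p hp => (closedBall_subset_cube p δ).trans ?_
  exact Set.subset_biUnion_of_mem (u := fun a => cube a (4 * δ))
    (Finset.mem_coe.2 (Finset.mem_image_of_mem _ hp))

lemma coverNum_mono {n : ℕ} {r : ℝ} {F F' : Set (EuclideanSpace ℝ (Fin n))} (h : F ⊆ F') :
    coverNum r F ≤ coverNum r F' :=
  biInf_mono fun _ hT => Set.Subset.trans h hT

/-- A nested sequence of compact sets whose differences contain the sphere has an
intersection with the same property. -/
lemma isDipoleKakeya_iInter {n : ℕ} {K : ℕ → Set (EuclideanSpace ℝ (Fin n))}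
    (hK : ∀ k, IsCompact (K k)) (hanti : ∀ k, K (k + 1) ⊆ K k)
    (hdiff : ∀ k, Metric.sphere (0 : EuclideanSpace ℝ (Fin n)) 1 ⊆ K k - K k) :
    IsDipoleKakeya (⋂ k, K k) ∧ IsCompact (⋂ k, K k) := by
  refine ⟨⟨(hK 0).isBounded.subset (Set.iInter_subset _ 0), fun e he => ?_⟩,
    (hK 0).of_isClosed_subset (isClosed_iInter fun k => (hK k).isClosed) (Set.iInter_subset _ 0)⟩
  have hclosed : ∀ k, IsClosed (K k ∩ (fun x => e + x) ⁻¹' K k) := fun k =>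
    (hK k).isClosed.inter ((hK k).isClosed.preimage (by fun_prop))
  obtain ⟨x, hx⟩ := IsCompact.nonempty_iInter_of_sequence_nonempty_isCompact_isClosed
    (fun k => K k ∩ (fun x => e + x) ⁻¹' K k)
    (fun k => Set.inter_subset_inter (hanti k) (Set.preimage_mono (hanti k)))
    (fun k => by
      obtain ⟨y, hy, x, hx, hyx⟩ := hdiff k he
      refine ⟨x, hx, ?_⟩
      have : e + x = y := by rw [← hyx]; exact sub_add_cancel y x
      simpa [this] using hy)
    ((hK 0).inter_right ((hK 0).isClosed.preimage (by fun_prop))) hclosed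
  rw [Set.mem_iInter] at hx
  exact ⟨e + x, Set.mem_iInter.2 fun k => (hx k).2, x, Set.mem_iInter.2 fun k => (hx k).1,
    add_sub_cancel_right e x⟩

theorem exists_compact_isDipoleKakeya (m : ℕ) :
    ∃ A : Set (EuclideanSpace ℝ (Fin (m + 1))), IsDipoleKakeya A ∧ IsCompact A ∧
      lowerBoxDim A ≤ ((((m : ℝ) + 1) * m / (2 * m + 1) : ℝ) : EReal) := by
  set d : ℝ := ((m : ℝ) + 1) * m / (2 * m + 1) with hd
  set St := {s : Finset (EuclideanSpace ℝ (Fin (m + 1))) × ℝ //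
    0 < s.2 ∧ DifferencesCover s.1 s.2}
  have hstep : ∀ (k : ℕ) (s : St), ∃ s' : St, s'.1.2 ≤ 1 / (4 * ((k : ℝ) + 1)) ∧
      2 * s'.1.2 ≤ s.1.2 ∧ (∀ p ∈ s'.1.1, ∃ p₀ ∈ s.1.1, dist p p₀ ≤ s.1.2) ∧
      (s'.1.1.card : ℝ) ≤ (4 * s'.1.2) ^ (-(d + 1 / ((k : ℝ) + 1))) := by
    intro k s
    obtain ⟨P', δ', h1, h2, h3, h4, h5, h6⟩ := s.2.2.exists_refinement s.2.1
      (q := d + 1 / ((k : ℝ) + 1)) (lt_add_of_pos_right _ (by positivity))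
      (ε := 1 / (4 * ((k : ℝ) + 1))) (by positivity)
    exact ⟨⟨(P', δ'), h1, h4⟩, h2, h3, h5, h6⟩
  choose f hfε hfδ hfP hfcard using hstep
  have hbase : DifferencesCover ({0} : Finset (EuclideanSpace ℝ (Fin (m + 1)))) 1 := by
    intro e he
    exact ⟨0, by simp, 0, by simp, by simp [he]⟩
  set s : ℕ → St := fun k => Nat.rec ⟨({0}, 1), one_pos, hbase⟩ f k
  have hs : ∀ k, s (k + 1) = f k (s k) := fun k => rfl
  have hdec : ∀ k, 2 * (s (k + 1)).1.2 ≤ (s k).1.2 := fun k => by rw [hs]; exact hfδ k _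
  obtain ⟨hA, hAc⟩ := isDipoleKakeya_iInter (K := fun k => thickening (s k).1.1 (s k).1.2)
    (fun k => isCompact_thickening _ _)
    (fun k y hy => by
      obtain ⟨p, hp, hyp⟩ := mem_thickening.1 hy
      obtain ⟨p₀, hp₀, hpp₀⟩ := hfP k (s k) p hp
      refine mem_thickening.2 ⟨p₀, hp₀, (dist_triangle y p p₀).trans ?_⟩
      linarith [hdec k])
    (fun k e he => by
      have hpos := (s k).2.1
      obtain ⟨x, hx, z, hz, h⟩ := (s k).2.2 e (by simpa using he)
      refine ⟨e + x, mem_thickening.2 ⟨z, hz, ?_⟩, x, mem_thickening.2 ⟨x, hx, ?_⟩,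
        add_sub_cancel_right e x⟩
      · rw [dist_eq_norm] at h ⊢
        rw [show e + x - z = e - (z - x) by abel]
        linarith
      · rw [dist_self]; linarith)
  refine ⟨_, hA, hAc, lowerBoxDim_le fun q hq => ?_⟩
  have htend : Tendsto (fun k : ℕ => 4 * (s (k + 1)).1.2) atTop (𝓝[>] 0) := by
    refine tendsto_nhdsWithin_iff.2 ⟨squeeze_zero (fun k => ?_) (fun k => ?_)
      tendsto_one_div_add_atTop_nhds_zero_nat, Eventually.of_forall fun k => ?_⟩
    · exact mul_nonneg (by norm_num) (s (k + 1)).2.1.le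
    · have h1 := hfε k (s k)
      rw [← hs, ← div_div, div_right_comm, le_div_iff₀ (by norm_num)] at h1
      linarith
    · exact mul_pos (by norm_num) (s (k + 1)).2.1
  refine htend.frequently (Eventually.frequently ?_)
  have hk : ∀ᶠ k : ℕ in atTop, 1 / ((k : ℝ) + 1) < q - d :=
    tendsto_one_div_add_atTop_nhds_zero_nat.eventually_lt_const (by linarith)
  filter_upwards [hk, (htend.mono_right nhdsWithin_le_nhds).eventually_lt_const one_pos]
    with k hk hk1
  have hpos : 0 < 4 * (s (k + 1)).1.2 := mul_pos (by norm_num) (s (k + 1)).2.1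
  have h1 : coverNum (4 * (s (k + 1)).1.2) (⋂ k, thickening (s k).1.1 (s k).1.2)
      ≤ (s (k + 1)).1.1.card :=
    (coverNum_mono (Set.iInter_subset _ (k + 1))).trans (coverNum_thickening_le _ _)
  have h2 : (((s (k + 1)).1.1.card : ℝ)) ≤ (4 * (s (k + 1)).1.2) ^ (-q) :=
    (hfcard k (s k)).trans
      (Real.rpow_le_rpow_of_exponent_ge hpos hk1.le (by linarith))
  calc _ ≤ (((s (k + 1)).1.1.card : ℕ∞) : ℝ≥0∞) := by exact_mod_cast h1
    _ = ENNReal.ofReal ((s (k + 1)).1.1.card : ℝ) := by simp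
    _ ≤ _ := ENNReal.ofReal_le_ofReal h2

theorem theorem1 :
    (∀ A : Set (EuclideanSpace ℝ (Fin 2)), IsDipoleKakeya A →
      ((4 / 7 : ℝ) : EReal) ≤ lowerBoxDim A ∧ ((2 / 3 : ℝ) : EReal) ≤ assouadDim A) ∧
    (∀ n : ℕ, 2 ≤ n → ∃ A : Set (EuclideanSpace ℝ (Fin n)),
      IsDipoleKakeya A ∧ IsCompact A ∧
        lowerBoxDim A ≤ (((n : ℝ) * ((n : ℝ) - 1) / (2 * (n : ℝ) - 1) : ℝ) : EReal)) := by
  refine ⟨fun A hA => ⟨four_sevenths_le_lowerBoxDim hA, two_thirds_le_assouadDim hA⟩,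
    fun n hn => ?_⟩
  obtain ⟨m, rfl⟩ : ∃ m, n = m + 1 := ⟨n - 1, by omega⟩
  obtain ⟨A, h1, h2, h3⟩ := exists_compact_isDipoleKakeya m
  refine ⟨A, h1, h2, h3.trans_eq ?_⟩
  congr 2
  · push_cast; ring
  · push_cast; ring
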